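/- Let $N\cong\mathbb Z^n$ be a lattice, $M=\mathrm{Hom}(N,\mathbb Z)$, and let $\Sigma$ be a smooth complete fan in $N_{\mathbb R}$ with primitive ray generators $v_1,\dots,v_d\in N$. Let $\lambda\in\mathbb Z^d$ be such that the line bundle $\mathcal O(\sum_k\lambda_kD_k)$ on the toric manifold $\check X=X_\Sigma$ is ample, put $l_k(x)=\langle x,v_k\rangle+\lambda_k$, and let $B=\{x\in M_{\mathbb R}: l_k(x)\ge 0,\ k=1,\dots,d\}$ be the moment polytope. Let $c_u\ge 0$ for $u\in B\cap M$, with $c_u>0$ when $u$ is a vertex of $B$, and let $$\phi(\xi)=\frac1{4\pi}\log\Big(\sum_{u\in B\cap M}c_u e^{4\pi\langle u,\xi\rangle}\Big),\qquad \xi\in N_{\mathbb R}.$$ Identify the fiberwise geodesic path space $P(L_0,L_\phi)$ of the zero section and $L_\phi=\{(\xi,[d\phi(\xi)])\}$ in $T^*N_{\mathbb R}/M$ with $N_{\mathbb R}\times M$, where $(\xi,m)$ stands for the path $s\mapsto[s(d\phi(\xi)+m)]$ in the fibre over $\xi$. On the component $N_{\mathbb R}\times\{m\}$ the Witten differential of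 a function is $$d_Wf=df+2\pi\Big(\sum_j\big(\tfrac{\partial\phi}{\partial\xi^j}+m_j\big)d\xi^j\Big)f .$$ A function $F$ on $N_{\mathbb R}\times M$ with values in $\mathbb C$ is rapidly decaying if each $F(\cdot,m)$ is smooth and, for each compact $K\subset N_{\mathbb R}$ and all $k,l\ge0$, $|d\phi(\xi)+m|^k\,|\nabla^lF(\xi,m)|\to0$ as $|d\phi(\xi)+m|\to\infty$, uniformly in $\xi\in K$. For a vertex $p$ of $B$, number the facets through $p$ as $l_1=\dots=l_n=0$, let $A\in GL(n,\mathbb Z)$ be the matrix with rows $v_1,\dots,v_n$, and use coordinates $t=(t^1,\dots,t^n)$ with $\xi=\sum_jt^jv_j={}^tA\,t$ and dual angles $y=(y^1,\dots,y^n)$, so that $Z^j=e^{2\pi(t^j-iy^j)}$ are the toric coordinates of the chart $\mathbb C^n$ at $p$. Let $\nabla$ be the Levi-Civita connection of the flat metric $\sum_j|dZ^j|^2$. Let $B_p$ be the union of the relative interiors of the faces of $B$ containing $p$ (including $\{p\}$ and $B$). A rapidly decaying $F$ is weakly extendable if for every vertex $p$, every precompact open $U\subset B_p$, every $k\ge0$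 and all coordinate indices $w_1,\dots,w_k$ (each $w_i$ being one of the coordinates $t^{j_i}$ or $y^{j_i}$) there is a constant $C>0$ such that, for all $m\in M$ and all $t$ with $d\phi({}^tA\,t)\in U$, and for every $y$, $$\Big|\nabla^k\big(F({}^tA\,t,\;A^{-1}m-p)\,e^{2\pi i\langle m,y\rangle}\big)(\partial_{w_1},\dots,\partial_{w_k})\Big|\le C\prod_{i=1}^k e^{2\pi t^{j_i}} .$$ A function on one component is called weakly extendable if its extension by zero to the other components is. For $u\in M$ put $f_u(\xi)=e^{-2\pi\phi(\xi)}e^{2\pi\langle u,\xi\rangle}$. Then, for every $m\in M$: 1. A function $f:N_{\mathbb R}\times\{m\}\to\mathbb C$ (in particular, a real-valued one) is a nontrivial weakly extendable solution of $d_Wf=0$ if and only if $u:=-m$ lies in $B\cap M$ and $f$ is a nonzero constant multiple of $f_u$. 2. If $u:=-m$ does not lie in $B$, then $f_u$ is a smooth solution of $d_Wf=0$ on $N_{\mathbb R}\times\{m\}$, and every smooth solution $f\not\equiv0$ of $d_Wf=0$ on that component is unbounded. -/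

import Mathlib

open scoped ContDiff

noncomputable section

namespace ToricSYZ

/-! Coordinates are chosen on the lattice: `N = ℤⁿ`, `N_ℝ = ℝⁿ`, and dually `M = ℤⁿ`, `M_ℝ = ℝⁿ`;
the pairing of `M_ℝ` with `N_ℝ` is the dot product. -/

/-- A lattice vector, seen in the real vector space. -/
def toReal {n : ℕ} (u : Fin n → ℤ) : Fin n → ℝ := fun i => (u i : ℝ)

/-- The cone spanned by the vectors `v k`, `k ∈ S`. -/
def cone {n d : ℕ} (v : Fin d → Fin n → ℤ) (S : Finset (Fin d)) : Set (Fin n → ℝ) :=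
  {ξ | ∃ t : Fin d → ℝ, (∀ k, 0 ≤ t k) ∧ ξ = ∑ k ∈ S, t k • toReal (v k)}

/-- A smooth complete fan in `N_ℝ` with `d` rays: `gen k` is the primitive generator of the
`k`-th ray, and a cone of maximal dimension is recorded by the set of its rays. The other cones
of the fan are the faces of these, i.e. the cones over subsets of the recorded sets. -/
structure SmoothCompleteFan (n d : ℕ) where
  gen : Fin d → Fin n → ℤ
  maxCones : Finset (Finset (Fin d))
  /-- smoothness: the generators of a maximal cone are a `ℤ`-basis of `N` -/
  linearIndependent : ∀ σ ∈ maxCones, LinearIndependent ℤ (fun k : σ => gen k)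
  span_eq_top : ∀ σ ∈ maxCones, Submodule.span ℤ (gen '' (σ : Set (Fin d))) = ⊤
  /-- two cones meet in a common face -/
  cone_inter : ∀ σ ∈ maxCones, ∀ τ ∈ maxCones, cone gen σ ∩ cone gen τ = cone gen (σ ∩ τ)
  /-- completeness -/
  complete : ∀ ξ : Fin n → ℝ, ∃ σ ∈ maxCones, ξ ∈ cone gen σ
  ray_mem : ∀ k, ∃ σ ∈ maxCones, k ∈ σ

namespace SmoothCompleteFan

variable {n d : ℕ} (X : SmoothCompleteFan n d) (lam : Fin d → ℤ)

/-- `O(∑ λₖ Dₖ)` is ample: its piecewise linear support function, which is given on the maximal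
cone `σ` by a lattice point `u` of `M` with `⟨u, vₖ⟩ = -λₖ` for `k ∈ σ`, is strictly convex. -/
def IsAmple : Prop :=
  ∀ σ ∈ X.maxCones, ∃ u : Fin n → ℤ,
    (∀ k ∈ σ, u ⬝ᵥ X.gen k = -lam k) ∧ (∀ k ∉ σ, -lam k < u ⬝ᵥ X.gen k)

/-- The affine function `lₖ(x) = ⟨x, vₖ⟩ + λₖ`. -/
def facetFn (k : Fin d) (x : Fin n → ℝ) : ℝ := x ⬝ᵥ toReal (X.gen k) + (lam k : ℝ)

/-- The moment polytope `B`. -/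
def polytope : Set (Fin n → ℝ) := {x | ∀ k, 0 ≤ X.facetFn lam k x}

/-- The lattice points `B ∩ M`. -/
def latticePoints : Set (Fin n → ℤ) := {u | toReal u ∈ X.polytope lam}

/-- The vertices `V(B)`, as lattice points (for an ample bundle on a smooth complete toric
variety every vertex of `B` is a lattice point). -/
def vertices : Set (Fin n → ℤ) := {p | toReal p ∈ (X.polytope lam).extremePoints ℝ}

/-- `B_p` for a vertex `p`: the union of the relative interiors of the faces of `B` that contain
`p` (among them `{p}` and `B`). A point `x` of `B` is in the relative interior of the face cut out
by the equations `lₖ = 0` that hold at `x`. -/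
def vertexStar (p : Fin n → ℤ) : Set (Fin n → ℝ) :=
  {x ∈ X.polytope lam | ∀ k, X.facetFn lam k x = 0 → X.facetFn lam k (toReal p) = 0}

/-- The potential `φ(ξ) = (1/4π) log ∑_{u ∈ B ∩ M} c_u e^{4π⟨u,ξ⟩}` on `N_ℝ`. -/
def potential (c : (Fin n → ℤ) → ℝ) (ξ : Fin n → ℝ) : ℝ :=
  1 / (4 * Real.pi) *
    Real.log (∑ᶠ u ∈ X.latticePoints lam, c u * Real.exp (4 * Real.pi * (toReal u ⬝ᵥ ξ)))

/-- The linear part `A` of `x ↦ (l_{e 1}(x), …, l_{e n}(x))`, where `e` enumerates the facets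
through the vertex `p`. -/
def chartMatrix {p : Fin n → ℤ} (e : Fin n ≃ {k : Fin d // X.facetFn lam k (toReal p) = 0}) :
    Matrix (Fin n) (Fin n) ℤ :=
  Matrix.of fun j i => X.gen (e j).1 i

end SmoothCompleteFan

/-- The differential `dφ : N_ℝ → M_ℝ`. -/
def differential {n : ℕ} (φ : (Fin n → ℝ) → ℝ) (ξ : Fin n → ℝ) : Fin n → ℝ :=
  fun j => fderiv ℝ φ ξ (Pi.single j 1)

/-! The fibrewise geodesic path space `P(L₀, L_φ)` of the zero section and the section
`ξ ↦ [dφ(ξ)]` of `T*N_ℝ / M` is identified with `N_ℝ × M`: the pair `(ξ, m)` stands for the class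
of the path `s ↦ [s (dφ(ξ) + m)]` in the torus over `ξ`. A function on the path space is written
as a family `F m ξ`, with `F m` its restriction to the component `N_ℝ × {m}`. -/

/-- The lift to `T*_ξ N_ℝ` of the geodesic that `(ξ, m)` stands for. -/
def geodesic {n : ℕ} (φ : (Fin n → ℝ) → ℝ) (ξ : Fin n → ℝ) (m : Fin n → ℤ) (s : ℝ) : Fin n → ℝ :=
  s • (differential φ ξ + toReal m)

/-- The velocity of `geodesic`. -/
def velocity {n : ℕ} (φ : (Fin n → ℝ) → ℝ) (ξ : Fin n → ℝ) (m : Fin n → ℤ) : Fin n → ℝ :=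
  differential φ ξ + toReal m

theorem hasDerivAt_geodesic {n : ℕ} (φ : (Fin n → ℝ) → ℝ) (ξ : Fin n → ℝ) (m : Fin n → ℤ) (s : ℝ) :
    HasDerivAt (geodesic φ ξ m) (velocity φ ξ m) s := by
  have h := (hasDerivAt_id s).smul_const (differential φ ξ + toReal m)
  rw [one_smul] at h
  exact h

/-- The Witten differential `d_W f = df + 2π (γ' ⌟ ω) f` of a function on the component
`N_ℝ × {m}`, with `γ' ⌟ ω = ∑ⱼ γ'ⱼ dξʲ`, evaluated at the point `ξ` on the tangent vector `w`. -/
def wittenD {n : ℕ} (φ : (Fin n → ℝ) → ℝ) (m : Fin n → ℤ) (f : (Fin n → ℝ) → ℂ)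
    (ξ w : Fin n → ℝ) : ℂ :=
  fderiv ℝ f ξ w + 2 * (Real.pi : ℂ) * ((velocity φ ξ m ⬝ᵥ w : ℝ) : ℂ) * f ξ

/-- A smooth solution of `d_W f = 0` on the component `N_ℝ × {m}`. -/
def IsWittenClosed {n : ℕ} (φ : (Fin n → ℝ) → ℝ) (m : Fin n → ℤ) (f : (Fin n → ℝ) → ℂ) : Prop :=
  ContDiff ℝ ∞ f ∧ ∀ ξ w, wittenD φ m f ξ w = 0

/-- `f_u(ξ) = e^{-2πφ(ξ)} e^{2π⟨u,ξ⟩}`. -/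
def wittenSolution {n : ℕ} (φ : (Fin n → ℝ) → ℝ) (u : Fin n → ℤ) (ξ : Fin n → ℝ) : ℂ :=
  ((Real.exp (-2 * Real.pi * φ ξ) * Real.exp (2 * Real.pi * (toReal u ⬝ᵥ ξ)) : ℝ) : ℂ)

/-- Rapidly decaying smooth functions on `P(L₀, L_φ)`: for each compact `K` in the base and all
`k`, `l`, the quantity `|γ'|^k |∇^l F|` tends to `0` as `|γ'| → ∞`, uniformly over `K`. The
connection is the flat one; as `K` is compact it does not matter which norms are used. -/
def RapidlyDecaying {n : ℕ} (φ : (Fin n → ℝ) → ℝ) (F : (Fin n → ℤ) → (Fin n → ℝ) → ℂ) : Prop :=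
  (∀ m, ContDiff ℝ ∞ (F m)) ∧
  ∀ K : Set (Fin n → ℝ), IsCompact K → ∀ k l : ℕ, ∀ ε : ℝ, 0 < ε → ∃ R : ℝ, ∀ ξ ∈ K, ∀ m,
    R ≤ ‖velocity φ ξ m‖ →
      ‖velocity φ ξ m‖ ^ k * ‖iteratedFDeriv ℝ l (F m) ξ‖ ≤ ε

/-! On `(ℂˣ)ⁿ` with holomorphic coordinates `Zʲ = e^{2π(tʲ - i yʲ)}`, use the real coordinates
`(t, y)`. The index `inl j` stands for `tʲ`, the index `inr j` for `yʲ`. -/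

/-- The Christoffel symbols `Γ^c_{ab}`, in the coordinates `(t, y)`, of the flat metric
`∑ⱼ |dZʲ|² = 4π² ∑ⱼ e^{4πtʲ} (dtʲ ⊗ dtʲ + dyʲ ⊗ dyʲ)`. -/
def christoffel {n : ℕ} : (c a b : Fin n ⊕ Fin n) → ℝ
  | .inl k, .inl i, .inl j => if i = k ∧ j = k then 2 * Real.pi else 0
  | .inl k, .inr i, .inr j => if i = k ∧ j = k then -(2 * Real.pi) else 0
  | .inr k, .inl i, .inr j => if i = k ∧ j = k then 2 * Real.pi else 0
  | .inr k, .inr i, .inl j => if i = k ∧ j = k then 2 * Real.pi else 0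
  | _, _, _ => 0

/-- The partial derivatives on the Fourier mode `g(t) e^{2πi⟨m,y⟩}`, written for `g`:
`∂/∂yʲ` becomes multiplication by `2πi mⱼ`. -/
def modePartial {n : ℕ} (m : Fin n → ℤ) (a : Fin n ⊕ Fin n) (g : (Fin n → ℝ) → ℂ) :
    (Fin n → ℝ) → ℂ :=
  match a with
  | .inl j => fun t => fderiv ℝ g t (Pi.single j 1)
  | .inr j => fun t => 2 * (Real.pi : ℂ) * Complex.I * (m j : ℂ) * g t

/-- The components `(∇ᵏ G)(∂_{w 0}, …, ∂_{w (k-1)})` of the iterated covariant derivative, for the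
flat metric above, of the Fourier mode `G = g(t) e^{2πi⟨m,y⟩}`, again written for `g`. With all
`t`-indices before all `y`-indices, or the other way round, these are the operators
`P̂_{IJ}`, `Q̂_{IJ}` applied to `g`. -/
def covDeriv {n : ℕ} (m : Fin n → ℤ) (g : (Fin n → ℝ) → ℂ) :
    (k : ℕ) → (Fin k → Fin n ⊕ Fin n) → (Fin n → ℝ) → ℂ
  | 0, _ => g
  | k + 1, w => fun t =>
      modePartial m (w 0) (covDeriv m g k (Fin.tail w)) t -
        ∑ i : Fin k, ∑ b : Fin n ⊕ Fin n, (christoffel b (w 0) (Fin.tail w i) : ℂ) *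
          covDeriv m g k (Function.update (Fin.tail w) i b) t

namespace SmoothCompleteFan

variable {n d : ℕ} (X : SmoothCompleteFan n d) (lam : Fin d → ℤ)

/-- The `m`-th Fourier coefficient of the transform `∑_m F(ξ,m) e^{2πi⟨m,y⟩}` of `F` in the chart
at the vertex `p`: the coordinates are `t` with `ξ = Aᵀ t`, i.e. `ξ = ∑ⱼ tʲ v_{e j}`, and the
unitary frame over the chart is `e^{-2πi⟨p,y⟩}` times the frame over the dense torus. -/
def chartMode {p : Fin n → ℤ} (e : Fin n ≃ {k : Fin d // X.facetFn lam k (toReal p) = 0})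
    (F : (Fin n → ℤ) → (Fin n → ℝ) → ℂ) (m : Fin n → ℤ) (t : Fin n → ℝ) : ℂ :=
  F ((X.chartMatrix lam e)⁻¹.mulVec m - p)
    (((X.chartMatrix lam e).map (Int.cast : ℤ → ℝ)).transpose.mulVec t)

/-- Weakly extendable functions on `P(L₀, L_φ)`: over every precompact open subset `U` of `B_p`,
`p` a vertex, the components of the covariant derivatives are bounded, up to a constant that is
uniform in the point and in the mode `m`, by the product of the lengths `e^{2πtʲ}` of the
coordinate vectors concerned. -/
def WeaklyExtendable (φ : (Fin n → ℝ) → ℝ) (F : (Fin n → ℤ) → (Fin n → ℝ) → ℂ) : Prop :=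
  RapidlyDecaying φ F ∧
  ∀ p ∈ X.vertices lam, ∀ e : Fin n ≃ {k : Fin d // X.facetFn lam k (toReal p) = 0},
  ∀ U : Set (Fin n → ℝ), (∃ O, IsOpen O ∧ U = O ∩ X.vertexStar lam p) →
    IsCompact (closure U) → closure U ⊆ X.vertexStar lam p →
  ∀ (k : ℕ) (w : Fin k → Fin n ⊕ Fin n), ∃ C : ℝ, 0 < C ∧ ∀ (m : Fin n → ℤ) (t : Fin n → ℝ),
    differential φ (((X.chartMatrix lam e).map (Int.cast : ℤ → ℝ)).transpose.mulVec t) ∈ U →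
      ‖covDeriv m (X.chartMode lam e F m) k w t‖ ≤
        C * ∏ i, Real.exp (2 * Real.pi * t (Sum.elim id id (w i)))

end SmoothCompleteFan

end ToricSYZ

end

noncomputable section

namespace ToricSYZ

/-! The factor `e^{2π(φ + ⟨m,ξ⟩)}` integrates `d_W f = 0`, so the solutions on the component of `m`
are the multiples of `f_u` with `u = -m`, and `|f_u|² = e^{4π⟨u,ξ⟩} / ∑ c_w e^{4π⟨w,ξ⟩}`. It remains
to compare growth of `f_u` with the position of `u`.

If `u ∈ B`, then in the chart at a vertex `p` the Fourier mode of `f_u` is `∏ (Zʲ)^{l_j(u)} · (∑ c_w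
∏ |Zʲ|^{2 l_j(w)})^{-1/2}`. The sum has constant term `c_p > 0`, so the mode extends smoothly to
`ℂⁿ` (`chartExtension_toricCoord`, `contDiff_chartExtension`). The components computed by `covDeriv`
are the ordinary derivatives of this extension on vectors of length `2π|Zʲ|`
(`frameDeriv_toricCoord`), hence satisfy the required bound wherever the `Zʲ` are bounded. Compact
subsets of `B_p` are such places (`IsAmple.exists_coord_le`): this is where completeness of the fan
and positivity of `c` at the vertices enter.

If `l_k(u) < 0`, then `f_u` grows exponentially along `-s v_k` (`exists_lt_norm_wittenSolution`).
The image of this ray under `dφ` stays in a compact part of `B_p` for a vertex `p` on the facet `k`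
(`le_facetFn_differential_ray`), so the order zero condition of weak extendability already bounds
`f` there, a contradiction. -/

/-! ### The flat connection in toric coordinates -/

/-- The toric coordinates `Zʲ = e^{2π(tʲ - i yʲ)}`. -/
def toricCoord {n : ℕ} (t y : Fin n → ℝ) : Fin n → ℂ :=
  fun j => Complex.exp (2 * Real.pi * ((t j : ℂ) - Complex.I * (y j : ℂ)))

/-- The factor by which `∂/∂tʲ` or `∂/∂yʲ` multiplies `Zʲ`. -/
def coordFactor {n : ℕ} : Fin n ⊕ Fin n → ℂ
  | .inl _ => 2 * Real.pi
  | .inr _ => -(2 * Real.pi * Complex.I)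

/-- The coordinate vector fields `∂/∂tʲ`, `∂/∂yʲ`, which depend linearly on `Z`. -/
def coordVector {n : ℕ} (a : Fin n ⊕ Fin n) : (Fin n → ℂ) →L[ℝ] (Fin n → ℂ) :=
  ((ContinuousLinearMap.single ℂ (fun _ : Fin n => ℂ) (Sum.elim id id a)).comp
    (coordFactor a • ContinuousLinearMap.proj (Sum.elim id id a))).restrictScalars ℝ

theorem coordVector_apply {n : ℕ} (a : Fin n ⊕ Fin n) (z : Fin n → ℂ) :
    coordVector a z = Pi.single (Sum.elim id id a) (coordFactor a * z (Sum.elim id id a)) := by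
  simp [coordVector, ← Pi.single_smul]

theorem norm_coordVector_le {n : ℕ} (a : Fin n ⊕ Fin n) (z : Fin n → ℂ) :
    ‖coordVector a z‖ ≤ 2 * Real.pi * ‖z (Sum.elim id id a)‖ := by
  rw [coordVector_apply, Pi.norm_single, norm_mul]
  refine le_of_eq ?_
  congr 1
  cases a <;> simp [coordFactor, abs_of_pos Real.pi_pos]

/-- The coordinate fields are linear in `Z`, so the left side is the flat derivative of the field
`b` along the field `a`. The identity thus certifies that `christoffel` belongs to the metric `∑
|dZʲ|²`; it reduces to multiplying the factors `2π` and `-2πi`. -/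
theorem coordVector_coordVector {n : ℕ} (a b : Fin n ⊕ Fin n) (z : Fin n → ℂ) :
    coordVector b (coordVector a z) = ∑ c, christoffel c a b • coordVector c z := by
  simp only [Fintype.sum_sum_type, coordVector_apply]
  ext l
  simp only [Pi.add_apply, Finset.sum_apply, Pi.smul_apply, Pi.single_apply]
  rcases a with i | i <;> rcases b with j | j <;>
    simp only [christoffel, Sum.elim_inl, Sum.elim_inr, id, coordFactor, ite_smul, zero_smul,
      Finset.sum_const_zero, add_zero, zero_add] <;>
    by_cases hij : i = j
  all_goals first
    | subst hij
      simp only [and_self, Finset.sum_ite_eq, Finset.mem_univ, if_true]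
      by_cases hl : l = i
      · simp [hl]
        try ring_nf
        try simp
        try ring_nf
      · simp [hl]
    | (rw [Finset.sum_eq_zero (fun k _ => if_neg (fun h => hij (h.1.trans h.2.symm)))]
       simp [Ne.symm hij])

theorem norm_toricCoord {n : ℕ} (t y : Fin n → ℝ) (j : Fin n) :
    ‖toricCoord t y j‖ = Real.exp (2 * Real.pi * t j) := by
  rw [toricCoord, Complex.norm_exp]
  congr 1
  simp

theorem hasFDerivAt_ofReal_apply {n : ℕ} (j : Fin n) (t : Fin n → ℝ) :
    HasFDerivAt (fun t : Fin n → ℝ => (t j : ℂ))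
      (Complex.ofRealCLM.comp (ContinuousLinearMap.proj (R := ℝ) (φ := fun _ => ℝ) j)) t :=
  (Complex.ofRealCLM.comp (ContinuousLinearMap.proj (R := ℝ) (φ := fun _ => ℝ) j)).hasFDerivAt

theorem hasFDerivAt_toricCoord_left {n : ℕ} (t y : Fin n → ℝ) :
    ∃ T : (Fin n → ℝ) →L[ℝ] (Fin n → ℂ), HasFDerivAt (fun t => toricCoord t y) T t ∧
      ∀ j, T (Pi.single j 1) = coordVector (.inl j) (toricCoord t y) := by
  refine ⟨ContinuousLinearMap.pi fun j =>
    ((toricCoord t y j * (2 * Real.pi)) •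
      (Complex.ofRealCLM.comp (ContinuousLinearMap.proj j))), ?_, ?_⟩
  · rw [hasFDerivAt_pi]
    intro j
    have h1 := hasFDerivAt_ofReal_apply j t
    have h2 := ((h1.sub_const (Complex.I * (y j : ℂ))).const_mul (2 * Real.pi : ℂ)).cexp
    rw [smul_smul] at h2
    exact h2
  · intro j
    rw [coordVector_apply]
    ext l
    by_cases hl : l = j
    · subst hl
      simp [coordFactor, mul_comm]
    · simp [hl]

theorem hasFDerivAt_toricCoord_right {n : ℕ} (t y : Fin n → ℝ) :
    ∃ T : (Fin n → ℝ) →L[ℝ] (Fin n → ℂ), HasFDerivAt (fun y => toricCoord t y) T y ∧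
      ∀ j, T (Pi.single j 1) = coordVector (.inr j) (toricCoord t y) := by
  refine ⟨ContinuousLinearMap.pi fun j =>
    ((toricCoord t y j * (-(2 * Real.pi * Complex.I))) •
      (Complex.ofRealCLM.comp (ContinuousLinearMap.proj j))), ?_, ?_⟩
  · rw [hasFDerivAt_pi]
    intro j
    have h1 := hasFDerivAt_ofReal_apply j y
    have h2 := (((h1.const_mul Complex.I).const_sub (t j : ℂ)).const_mul (2 * Real.pi : ℂ)).cexp
    refine h2.congr_fderiv ?_
    ext v
    simp [toricCoord]
    ring
  · intro j
    rw [coordVector_apply]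
    ext l
    by_cases hl : l = j
    · subst hl
      simp [coordFactor, mul_comm]
    · simp [hl]

/-- The components of the `k`-th derivative of `G` in the coordinate frame, as a function of `Z`. -/
def frameDeriv {n : ℕ} (G : (Fin n → ℂ) → ℂ) (k : ℕ) (w : Fin k → Fin n ⊕ Fin n)
    (z : Fin n → ℂ) : ℂ :=
  iteratedFDeriv ℝ k G z (fun i => coordVector (w i) z)

/-- The product rule: the derivative falls on `DᵏG` or on one of the frame fields, and the latter
terms expand in Christoffel symbols. Solved for the term of order `k + 1`, this is the recursion
defining `covDeriv`. -/
theorem exists_hasFDerivAt_frameDeriv {n : ℕ} {G : (Fin n → ℂ) → ℂ} (hG : ContDiff ℝ ∞ G) (k : ℕ)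
    (w : Fin k → Fin n ⊕ Fin n) (z : Fin n → ℂ) :
    ∃ T : (Fin n → ℂ) →L[ℝ] ℂ, HasFDerivAt (frameDeriv G k w) T z ∧
      ∀ a, T (coordVector a z) = frameDeriv G (k + 1) (Fin.cons a w) z +
        ∑ i : Fin k, ∑ b, (christoffel b a (w i) : ℂ) *
          frameDeriv G k (Function.update w i b) z := by
  have h1 : HasFDerivAt (iteratedFDeriv ℝ k G) (fderiv ℝ (iteratedFDeriv ℝ k G) z) z :=
    ((hG.differentiable_iteratedFDeriv (m := k)
      (by exact_mod_cast WithTop.coe_lt_top _)) z).hasFDerivAt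
  have h2 := h1.continuousMultilinearMap_apply (g := fun i => coordVector (w i))
    (fun i => (coordVector (w i)).hasFDerivAt)
  refine ⟨_, h2, fun a => ?_⟩
  simp only [add_apply, sum_apply,
    ContinuousLinearMap.comp_apply, ContinuousMultilinearMap.apply_apply]
  congr 1
  refine Finset.sum_congr rfl fun i _ => ?_
  rw [coordVector_coordVector, map_sum]
  refine Finset.sum_congr rfl fun b _ => ?_
  rw [map_smul, ContinuousMultilinearMap.toContinuousLinearMap_apply, Complex.real_smul, frameDeriv]
  congr 3
  ext1 l
  by_cases hl : l = i
  · subst hl; simp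
  · simp [hl]

/-! ### Fourier modes and their covariant derivatives -/

/-- The character `e^{2πi⟨m,y⟩}`. -/
def modeChar {n : ℕ} (m : Fin n → ℤ) (y : Fin n → ℝ) : ℂ :=
  Complex.exp (2 * Real.pi * Complex.I * ∑ j, (m j : ℂ) * (y j : ℂ))

theorem modeChar_ne_zero {n : ℕ} (m : Fin n → ℤ) (y : Fin n → ℝ) : modeChar m y ≠ 0 :=
  Complex.exp_ne_zero _

theorem modeChar_zero {n : ℕ} (m : Fin n → ℤ) : modeChar m 0 = 1 := by
  simp [modeChar]

theorem exists_hasFDerivAt_modeChar {n : ℕ} (m : Fin n → ℤ) (y : Fin n → ℝ) :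
    ∃ T : (Fin n → ℝ) →L[ℝ] ℂ, HasFDerivAt (modeChar m) T y ∧
      ∀ j, T (Pi.single j 1) = 2 * Real.pi * Complex.I * m j * modeChar m y := by
  have h2 := ((HasFDerivAt.fun_sum fun j (_ : j ∈ Finset.univ) =>
    (hasFDerivAt_ofReal_apply j y).const_mul (m j : ℂ)).const_mul (2 * Real.pi * Complex.I : ℂ)).cexp
  refine ⟨_, h2, fun j => ?_⟩
  have hs : ∑ i, (m i : ℂ) * (((Pi.single j (1 : ℝ) : Fin n → ℝ) i : ℝ) : ℂ) = m j := by
    rw [Finset.sum_eq_single j (by intro l _ hl; simp [hl]) (by simp)]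
    simp
  simp only [smul_apply, sum_apply, ContinuousLinearMap.comp_apply, ContinuousLinearMap.proj_apply,
    smul_eq_mul, Complex.ofRealCLM_apply, hs, modeChar]
  ring

/-- Links the recursive `covDeriv` to true derivatives on `ℂⁿ`. Differentiability of the components
in `t` is inherited from `G`, by dividing by the nowhere vanishing character; in the `y` directions
only the character is differentiated. -/
theorem frameDeriv_toricCoord {n : ℕ} {G : (Fin n → ℂ) → ℂ} (hG : ContDiff ℝ ∞ G)
    (m : Fin n → ℤ) (g : (Fin n → ℝ) → ℂ)
    (h : ∀ t y, G (toricCoord t y) = modeChar m y * g t) (k : ℕ) :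
    ∀ (w : Fin k → Fin n ⊕ Fin n) (t y : Fin n → ℝ),
      frameDeriv G k w (toricCoord t y) = modeChar m y * covDeriv m g k w t := by
  induction k with
  | zero =>
    intro w t y
    simp [frameDeriv, covDeriv, h]
  | succ k ih =>
    intro w t y
    obtain ⟨T, hT, hTa⟩ := exists_hasFDerivAt_frameDeriv hG k (Fin.tail w) (toricCoord t y)
    have key : modeChar m y * modePartial m (w 0) (covDeriv m g k (Fin.tail w)) t =
        T (coordVector (w 0) (toricCoord t y)) := by
      cases h0 : w 0 with
      | inl j =>
        obtain ⟨S, hS, hSj⟩ := hasFDerivAt_toricCoord_left t y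
        have h1 := hT.comp t hS
        have h2 : (frameDeriv G k (Fin.tail w) ∘ fun t => toricCoord t y) =
            fun t => modeChar m y * covDeriv m g k (Fin.tail w) t := by
          ext t'
          exact ih _ _ _
        rw [h2] at h1
        have h3 : HasFDerivAt (covDeriv m g k (Fin.tail w))
            ((modeChar m y)⁻¹ • T.comp S) t := by
          have := h1.const_mul (modeChar m y)⁻¹
          simpa [← mul_assoc, inv_mul_cancel₀ (modeChar_ne_zero m y)] using this
        simp only [modePartial]
        rw [h3.fderiv, smul_apply, smul_eq_mul,
          mul_inv_cancel_left₀ (modeChar_ne_zero m y), ContinuousLinearMap.comp_apply, hSj]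
      | inr j =>
        obtain ⟨S, hS, hSj⟩ := hasFDerivAt_toricCoord_right t y
        have h1 := hT.comp y hS
        have h2 : (frameDeriv G k (Fin.tail w) ∘ fun y => toricCoord t y) =
            fun y => modeChar m y * covDeriv m g k (Fin.tail w) t := by
          ext y'
          exact ih _ _ _
        rw [h2] at h1
        obtain ⟨E, hE, hEj⟩ := exists_hasFDerivAt_modeChar m y
        have h3 := h1.unique (hE.mul_const (covDeriv m g k (Fin.tail w) t))
        rw [← hSj, ← ContinuousLinearMap.comp_apply, h3]
        simp only [modePartial, smul_apply, smul_eq_mul, hEj]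
        ring
    rw [covDeriv, mul_sub, key, hTa, Fin.cons_self_tail, Finset.mul_sum]
    rw [eq_sub_iff_add_eq]
    congr 1
    refine Finset.sum_congr rfl fun i _ => ?_
    rw [Finset.mul_sum]
    refine Finset.sum_congr rfl fun b _ => ?_
    rw [ih]
    ring

theorem covDeriv_zero {n : ℕ} (m : Fin n → ℤ) (k : ℕ) (w : Fin k → Fin n ⊕ Fin n) :
    covDeriv m (fun _ => 0) k w = fun _ => 0 := by
  induction k with
  | zero => rfl
  | succ k ih =>
    ext t
    simp only [covDeriv, ih, mul_zero, Finset.sum_const_zero, sub_zero]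
    cases w 0 <;> simp [modePartial]

/-- The components of the covariant derivatives of a mode that extends smoothly to `ℂⁿ` are
bounded, in terms of the lengths of the coordinate vectors, over bounded subsets of `ℂⁿ`. -/
theorem exists_norm_covDeriv_le {n : ℕ} {G : (Fin n → ℂ) → ℂ} (hG : ContDiff ℝ ∞ G)
    (m : Fin n → ℤ) (g : (Fin n → ℝ) → ℂ)
    (h : ∀ t y, G (toricCoord t y) = modeChar m y * g t) (R : ℝ) (k : ℕ)
    (w : Fin k → Fin n ⊕ Fin n) :
    ∃ C : ℝ, 0 < C ∧ ∀ t : Fin n → ℝ, (∀ j, t j ≤ R) →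
      ‖covDeriv m g k w t‖ ≤ C * ∏ i, Real.exp (2 * Real.pi * t (Sum.elim id id (w i))) := by
  have hcont : Continuous (iteratedFDeriv ℝ k G) :=
    hG.continuous_iteratedFDeriv (by exact_mod_cast le_top)
  obtain ⟨D, hD⟩ := (isCompact_closedBall (0 : Fin n → ℂ)
    (Real.exp (2 * Real.pi * R))).exists_bound_of_continuousOn hcont.continuousOn
  -- `D` bounds the `k`-th derivative on the polydisc of radius `e^{2πR}`, each frame vector
  -- contributes a factor `2π`, and the `+ 1` keeps the constant positive.
  refine ⟨(|D| + 1) * (2 * Real.pi) ^ k, by have := Real.pi_pos; positivity, fun t ht => ?_⟩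
  have h1 := frameDeriv_toricCoord hG m g h k w t 0
  rw [modeChar_zero, one_mul] at h1
  rw [← h1, frameDeriv]
  have hmem : toricCoord t 0 ∈ Metric.closedBall (0 : Fin n → ℂ) (Real.exp (2 * Real.pi * R)) := by
    rw [mem_closedBall_zero_iff, pi_norm_le_iff_of_nonneg (Real.exp_pos _).le]
    intro j
    rw [norm_toricCoord]
    have := ht j
    gcongr
  refine (ContinuousMultilinearMap.le_opNorm _ _).trans ?_
  rw [mul_assoc]
  gcongr
  · exact (hD _ hmem).trans ((le_abs_self D).trans (by linarith))
  · calc ∏ i, ‖coordVector (w i) (toricCoord t 0)‖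
        ≤ ∏ i, (2 * Real.pi * Real.exp (2 * Real.pi * t (Sum.elim id id (w i)))) := by
          refine Finset.prod_le_prod (fun _ _ => norm_nonneg _) fun i _ => ?_
          rw [← norm_toricCoord t 0]
          exact norm_coordVector_le _ _
      _ = _ := by
          rw [Finset.prod_mul_distrib, Finset.prod_const, Finset.card_univ, Fintype.card_fin]

/-! ### The polytope of an ample line bundle -/

theorem toReal_dotProduct {n : ℕ} (u v : Fin n → ℤ) :
    toReal u ⬝ᵥ toReal v = ((u ⬝ᵥ v : ℤ) : ℝ) := by
  simp [dotProduct, toReal]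

theorem toReal_add {n : ℕ} (u v : Fin n → ℤ) : toReal (u + v) = toReal u + toReal v := by
  ext; simp [toReal]

theorem toReal_sub {n : ℕ} (u v : Fin n → ℤ) : toReal (u - v) = toReal u - toReal v := by
  ext; simp [toReal]

theorem toReal_neg {n : ℕ} (u : Fin n → ℤ) : toReal (-u) = -toReal u := by
  ext; simp [toReal]

theorem toReal_single {n : ℕ} (j : Fin n) :
    toReal (Pi.single j 1) = (Pi.single j 1 : Fin n → ℝ) := by
  ext i
  by_cases h : i = j
  · subst h; simp [toReal]
  · simp [toReal, h]

namespace SmoothCompleteFan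

variable {n d : ℕ} (X : SmoothCompleteFan n d) (lam : Fin d → ℤ)

theorem facetFn_toReal (k : Fin d) (u : Fin n → ℤ) :
    X.facetFn lam k (toReal u) = ((u ⬝ᵥ X.gen k + lam k : ℤ) : ℝ) := by
  rw [facetFn, toReal_dotProduct]
  push_cast
  rfl

theorem continuous_facetFn (k : Fin d) : Continuous (X.facetFn lam k) := by
  unfold facetFn dotProduct
  fun_prop

theorem maxCones_nonempty : X.maxCones.Nonempty :=
  let ⟨σ, hσ, _⟩ := X.complete 0
  ⟨σ, hσ⟩

variable {X} in
/-- The generators of a maximal cone span, so they separate the points of the dual space. -/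
theorem eq_zero_of_dotProduct_gen_eq_zero {σ : Finset (Fin d)} (hσ : σ ∈ X.maxCones)
    {x : Fin n → ℝ} (hx : ∀ k ∈ σ, x ⬝ᵥ toReal (X.gen k) = 0) : x = 0 := by
  have h : ∀ w : Fin n → ℤ, x ⬝ᵥ toReal w = 0 := by
    intro w
    have hw : w ∈ Submodule.span ℤ (X.gen '' (σ : Set (Fin d))) := by
      rw [X.span_eq_top σ hσ]; trivial
    induction hw using Submodule.span_induction with
    | mem w hw =>
      obtain ⟨k, hk, rfl⟩ := hw
      exact hx k hk
    | zero => simp [dotProduct, toReal]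
    | add u v _ _ hu hv => rw [toReal_add, dotProduct_add, hu, hv, add_zero]
    | smul a u _ hu =>
      have : toReal (a • u) = (a : ℝ) • toReal u := by ext; simp [toReal]
      rw [this, dotProduct_smul, hu, smul_zero]
  ext j
  simpa [toReal_single] using h (Pi.single j 1)

variable {X} in
theorem card_maxCone {σ : Finset (Fin d)} (hσ : σ ∈ X.maxCones) : σ.card = n := by
  have hs : ⊤ ≤ Submodule.span ℤ (Set.range fun k : σ => X.gen k) := by
    rw [← X.span_eq_top σ hσ]
    refine Submodule.span_mono ?_
    rintro _ ⟨k, hk, rfl⟩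
    exact ⟨⟨k, hk⟩, rfl⟩
  have b := Module.finrank_eq_card_basis (Module.Basis.mk (X.linearIndependent σ hσ) hs)
  simpa using b.symm

variable {X} in
/-- A linear function on a cone, with nonnegative weights on the generators. -/
theorem exists_nonneg_coeff (ξ : Fin n → ℝ) :
    ∃ σ ∈ X.maxCones, ∃ s : Fin d → ℝ, (∀ k, 0 ≤ s k) ∧
      ∀ x : Fin n → ℝ, x ⬝ᵥ ξ = ∑ k ∈ σ, s k * (x ⬝ᵥ toReal (X.gen k)) := by
  obtain ⟨σ, hσ, s, hs, rfl⟩ := X.complete ξ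
  refine ⟨σ, hσ, s, hs, fun x => ?_⟩
  simp [dotProduct_sum, dotProduct_smul]

variable {X lam}

theorem IsAmple.exists_facetFn (hlam : X.IsAmple lam) {σ : Finset (Fin d)} (hσ : σ ∈ X.maxCones) :
    ∃ p : Fin n → ℤ, p ∈ X.latticePoints lam ∧ ∀ k, X.facetFn lam k (toReal p) = 0 ↔ k ∈ σ := by
  obtain ⟨u, hu, hu'⟩ := hlam σ hσ
  refine ⟨u, fun k => ?_, fun k => ?_⟩ <;> rw [facetFn_toReal] <;> by_cases hk : k ∈ σ
  · rw [hu k hk]; simp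
  · exact_mod_cast (by linarith [hu' k hk] : (0 : ℤ) ≤ u ⬝ᵥ X.gen k + lam k)
  · simp [hu k hk, hk]
  · simp only [hk, iff_false]
    exact_mod_cast (by linarith [hu' k hk] : (0 : ℤ) < u ⬝ᵥ X.gen k + lam k).ne'

/-- At the Cartier datum of `σ` the functions `l_k`, `k ∈ σ`, attain their minimum `0` on `B`. They
therefore vanish at an endpoint of any segment of `B` through that point, and together they
determine the point. -/
theorem IsAmple.exists_vertex (hlam : X.IsAmple lam) {σ : Finset (Fin d)} (hσ : σ ∈ X.maxCones) :
    ∃ p ∈ X.vertices lam, ∀ k, X.facetFn lam k (toReal p) = 0 ↔ k ∈ σ := by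
  obtain ⟨p, hp, hpσ⟩ := hlam.exists_facetFn hσ
  refine ⟨p, ?_, hpσ⟩
  refine ⟨hp, fun x hx y hy hxy => ?_⟩
  obtain ⟨a, b, ha, hb, hab, hp'⟩ := hxy
  have h : ∀ k ∈ σ, (x - toReal p) ⬝ᵥ toReal (X.gen k) = 0 := by
    intro k hk
    have h0 := (hpσ k).2 hk
    have h1 := hx k
    have h2 := hy k
    have h3 : X.facetFn lam k (toReal p) =
        a * X.facetFn lam k x + b * X.facetFn lam k y := by
      rw [← hp']
      simp only [facetFn, add_dotProduct, smul_dotProduct, smul_eq_mul]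
      linear_combination -(lam k : ℝ) * hab
    have h4 : X.facetFn lam k x = 0 := by
      have : a * X.facetFn lam k x = 0 := by nlinarith [mul_nonneg ha.le h1, mul_nonneg hb.le h2]
      exact (mul_eq_zero.1 this).resolve_left ha.ne'
    rw [sub_dotProduct]
    simp only [facetFn] at h0 h4
    linarith
  exact sub_eq_zero.1 (eq_zero_of_dotProduct_gen_eq_zero hσ h)

theorem mem_latticePoints_of_mem_vertices {p : Fin n → ℤ} (hp : p ∈ X.vertices lam) :
    p ∈ X.latticePoints lam := hp.1

/-- The facets through an extreme point have normals that span. -/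
theorem eq_zero_of_mem_vertices {p : Fin n → ℤ} (hp : p ∈ X.vertices lam) {w : Fin n → ℝ}
    (hw : ∀ k, X.facetFn lam k (toReal p) = 0 → w ⬝ᵥ toReal (X.gen k) = 0) : w = 0 := by
  -- Both `p + εw` and `p - εw` remain in `B` for small `ε`: active constraints are constant along
  -- `w`, the others are slack. Extremality then gives `w = 0`.
  have hev : ∀ᶠ ε : ℝ in nhds 0, ∀ k, 0 ≤ X.facetFn lam k (toReal p + ε • w) := by
    rw [Filter.eventually_all]
    intro k
    by_cases hk : X.facetFn lam k (toReal p) = 0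
    · refine Filter.Eventually.of_forall fun ε => ?_
      have : X.facetFn lam k (toReal p + ε • w) = X.facetFn lam k (toReal p) := by
        simp [facetFn, add_dotProduct, smul_dotProduct, hw k hk]
      rw [this, hk]
    · have hpos : 0 < X.facetFn lam k (toReal p) := lt_of_le_of_ne (hp.1 k) (Ne.symm hk)
      have hc : Continuous fun ε : ℝ => X.facetFn lam k (toReal p + ε • w) :=
        (X.continuous_facetFn lam k).comp (by fun_prop)
      have := hc.tendsto 0
      simp only [zero_smul, add_zero] at this
      exact (this.eventually (lt_mem_nhds hpos)).mono fun _ h => le_of_lt h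
  obtain ⟨δ, hδ, hball⟩ := Metric.eventually_nhds_iff.1 hev
  have h1 : toReal p + (δ / 2) • w ∈ X.polytope lam :=
    hball (by simp [abs_of_pos hδ, hδ])
  have h2 : toReal p + (-(δ / 2)) • w ∈ X.polytope lam :=
    hball (by simp [abs_of_pos hδ, hδ])
  have h3 := hp.2 h1 h2 ⟨1 / 2, 1 / 2, by norm_num, by norm_num, by norm_num, by
    ext i; simp; ring⟩
  have h4 : (δ / 2) • w = 0 := by simpa using h3
  exact (smul_eq_zero.1 h4).resolve_left (by positivity)

/-- The sum of the normals at `p` lies in some cone `σ`, so the vertex `u` of `σ` minimises the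
pairing with it over `B`. Comparison with `p` makes every `l_k` active at `p` vanish at `u` as well,
whence `u = p`. -/
theorem IsAmple.exists_maxCone_of_mem_vertices (hlam : X.IsAmple lam) {p : Fin n → ℤ}
    (hp : p ∈ X.vertices lam) :
    ∃ σ ∈ X.maxCones, ∀ k, X.facetFn lam k (toReal p) = 0 ↔ k ∈ σ := by
  classical
  set S : Finset (Fin d) := Finset.univ.filter fun k => X.facetFn lam k (toReal p) = 0 with hS
  obtain ⟨σ, hσ, s, hs, hx⟩ := X.exists_nonneg_coeff (∑ k ∈ S, toReal (X.gen k))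
  obtain ⟨u, hu, huσ⟩ := hlam.exists_facetFn hσ
  have h1 : toReal u ⬝ᵥ ∑ k ∈ S, toReal (X.gen k) ≤ toReal p ⬝ᵥ ∑ k ∈ S, toReal (X.gen k) := by
    rw [hx, hx]
    refine Finset.sum_le_sum fun k hk => mul_le_mul_of_nonneg_left ?_ (hs k)
    have h2 := (huσ k).2 hk
    have h3 := hp.1 k
    simp only [facetFn] at h2 h3
    linarith
  have h2 : ∑ k ∈ S, X.facetFn lam k (toReal u) ≤ ∑ k ∈ S, X.facetFn lam k (toReal p) := by
    simp only [facetFn, Finset.sum_add_distrib, dotProduct_sum] at h1 ⊢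
    linarith
  have h3 : ∑ k ∈ S, X.facetFn lam k (toReal p) = 0 :=
    Finset.sum_eq_zero fun k hk => by simpa [hS] using hk
  have h4 : ∀ k ∈ S, X.facetFn lam k (toReal u) = 0 :=
    (Finset.sum_eq_zero_iff_of_nonneg fun k _ => hu k).1
      (le_antisymm (h2.trans_eq h3) (Finset.sum_nonneg fun k _ => hu k))
  have h5 : toReal u - toReal p = 0 := by
    refine eq_zero_of_mem_vertices hp fun k hk => ?_
    have h6 := h4 k (by simpa [hS] using hk)
    rw [sub_dotProduct]
    simp only [facetFn] at h6 hk
    linarith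
  refine ⟨σ, hσ, fun k => ?_⟩
  rw [← huσ, sub_eq_zero.1 h5]

/-- By completeness every `ξ` is a nonnegative combination of generators, so `⟨·, ξ⟩` is bounded
below on `B`; this is applied to plus and minus the basis vectors. -/
theorem isBounded_polytope : Bornology.IsBounded (X.polytope lam) := by
  have h : ∀ ξ : Fin n → ℝ, ∃ C : ℝ, ∀ x ∈ X.polytope lam, C ≤ x ⬝ᵥ ξ := by
    intro ξ
    obtain ⟨σ, hσ, s, hs, hx⟩ := X.exists_nonneg_coeff ξ
    refine ⟨∑ k ∈ σ, s k * (-lam k), fun x hxB => ?_⟩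
    rw [hx]
    refine Finset.sum_le_sum fun k _ => mul_le_mul_of_nonneg_left ?_ (hs k)
    have := hxB k
    simp only [facetFn] at this
    linarith
  choose C hC using h
  rw [isBounded_iff_forall_norm_le]
  refine ⟨∑ j, (|C (Pi.single j 1)| + |C (-Pi.single j 1)|), fun x hx => ?_⟩
  rw [pi_norm_le_iff_of_nonneg (by positivity)]
  intro j
  refine le_trans ?_ (Finset.single_le_sum
    (f := fun j => |C (Pi.single j 1)| + |C (-Pi.single j 1)|) (fun _ _ => by positivity)
    (Finset.mem_univ j))
  have h1 := hC (Pi.single j 1) x hx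
  have h2 := hC (-Pi.single j 1) x hx
  simp only [dotProduct_neg, dotProduct_single_one] at h1 h2
  rw [Real.norm_eq_abs, abs_le]
  constructor
  · linarith [neg_abs_le (C (Pi.single j 1)), abs_nonneg (C (-Pi.single j 1))]
  · linarith [neg_abs_le (C (-Pi.single j 1)), abs_nonneg (C (Pi.single j 1))]

theorem isClosed_polytope : IsClosed (X.polytope lam) := by
  simp only [polytope, Set.ofPred_forall]
  exact isClosed_iInter fun k => isClosed_le continuous_const (X.continuous_facetFn lam k)

theorem isCompact_polytope : IsCompact (X.polytope lam) :=
  Metric.isCompact_of_isClosed_isBounded isClosed_polytope isBounded_polytope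

theorem finite_latticePoints : (X.latticePoints lam).Finite := by
  obtain ⟨R, hR⟩ := (isBounded_iff_forall_norm_le).1 (isBounded_polytope (X := X) (lam := lam))
  refine (Set.finite_Icc (fun _ : Fin n => -⌈R⌉) (fun _ => ⌈R⌉)).subset fun u hu => ?_
  have h : ∀ j, |(u j : ℝ)| ≤ ⌈R⌉ := fun j =>
    ((norm_le_pi_norm (toReal u) j).trans (hR _ hu)).trans (Int.le_ceil R)
  exact ⟨fun j => by exact_mod_cast (abs_le.1 (h j)).1, fun j => by exact_mod_cast (abs_le.1 (h j)).2⟩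

/-- The facets through a vertex give a chart: `A` is invertible over `ℤ`. -/
theorem IsAmple.isUnit_det_chartMatrix (hlam : X.IsAmple lam) {p : Fin n → ℤ}
    (hp : p ∈ X.vertices lam) (e : Fin n ≃ {k : Fin d // X.facetFn lam k (toReal p) = 0}) :
    IsUnit (X.chartMatrix lam e).det := by
  obtain ⟨σ, hσ, hpσ⟩ := hlam.exists_maxCone_of_mem_vertices hp
  have hs : Submodule.span ℤ (Set.range (X.chartMatrix lam e).row) = ⊤ := by
    rw [← top_le_iff, ← X.span_eq_top σ hσ]
    refine Submodule.span_mono ?_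
    rintro _ ⟨k, hk, rfl⟩
    refine ⟨e.symm ⟨k, (hpσ k).2 hk⟩, ?_⟩
    ext i
    simp [chartMatrix]
  rw [← Matrix.isUnit_iff_isUnit_det, ← Matrix.vecMul_surjective_iff_isUnit,
    ← Matrix.coe_vecMulLinear, ← LinearMap.range_eq_top, range_vecMulLinear]
  exact hs

theorem IsAmple.exists_chart (hlam : X.IsAmple lam) {p : Fin n → ℤ} (hp : p ∈ X.vertices lam) :
    Nonempty (Fin n ≃ {k : Fin d // X.facetFn lam k (toReal p) = 0}) := by
  obtain ⟨σ, hσ, hpσ⟩ := hlam.exists_maxCone_of_mem_vertices hp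
  refine ⟨(σ.equivFinOfCardEq (card_maxCone hσ)).symm.trans
    (Equiv.subtypeEquivRight fun k => (hpσ k).symm)⟩

theorem toReal_dotProduct_chart {p : Fin n → ℤ}
    (e : Fin n ≃ {k : Fin d // X.facetFn lam k (toReal p) = 0}) (x t : Fin n → ℝ) :
    x ⬝ᵥ (((X.chartMatrix lam e).map (Int.cast : ℤ → ℝ)).transpose.mulVec t) =
      ∑ j, t j * (x ⬝ᵥ toReal (X.gen (e j).1)) := by
  rw [Matrix.mulVec_transpose, dotProduct_comm, ← Matrix.dotProduct_mulVec]
  simp [dotProduct, Matrix.mulVec, chartMatrix, toReal, mul_comm]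

/-- The basis dual to the generators of the cone of a chart. -/
theorem IsAmple.exists_dual (hlam : X.IsAmple lam) {p : Fin n → ℤ}
    (hp : p ∈ X.vertices lam) (e : Fin n ≃ {k : Fin d // X.facetFn lam k (toReal p) = 0}) :
    ∃ a : Fin n → Fin n → ℤ, ∀ i j, a j ⬝ᵥ X.gen (e i).1 = if i = j then 1 else 0 := by
  have h := Matrix.mul_nonsing_inv _ (hlam.isUnit_det_chartMatrix hp e)
  refine ⟨fun j l => (X.chartMatrix lam e)⁻¹ l j, fun i j => ?_⟩
  have := congrFun (congrFun h i) j
  rw [Matrix.mul_apply, Matrix.one_apply] at this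
  rw [← this, dotProduct_comm]
  rfl

end SmoothCompleteFan

/-! ### Solutions of the Witten equation -/

theorem differential_dotProduct {n : ℕ} (φ : (Fin n → ℝ) → ℝ) (ξ v : Fin n → ℝ) :
    differential φ ξ ⬝ᵥ v = fderiv ℝ φ ξ v := by
  conv_rhs => rw [pi_eq_sum_univ' v, map_sum]
  simp [dotProduct, differential, mul_comm, Pi.single]

theorem continuous_differential {n : ℕ} {φ : (Fin n → ℝ) → ℝ} (hφ : ContDiff ℝ ∞ φ) :
    Continuous (differential φ) :=
  continuous_pi fun _ => (hφ.continuous_fderiv (by simp)).clm_apply continuous_const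

/-- The linear form `ξ ↦ ⟨x, ξ⟩`. -/
def dotCLM {n : ℕ} (x : Fin n → ℝ) : (Fin n → ℝ) →L[ℝ] ℝ :=
  LinearMap.toContinuousLinearMap (dotProductBilin ℝ ℝ x)

theorem dotCLM_apply {n : ℕ} (x ξ : Fin n → ℝ) : dotCLM x ξ = x ⬝ᵥ ξ := rfl

theorem hasFDerivAt_dotProduct {n : ℕ} (x ξ : Fin n → ℝ) :
    HasFDerivAt (fun ξ => x ⬝ᵥ ξ) (dotCLM x) ξ :=
  (dotCLM x).hasFDerivAt

theorem contDiff_dotProduct {n : ℕ} (x : Fin n → ℝ) :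
    ContDiff ℝ ∞ (fun ξ => x ⬝ᵥ ξ) :=
  (dotCLM x).contDiff

theorem wittenSolution_eq {n : ℕ} (φ : (Fin n → ℝ) → ℝ) (u : Fin n → ℤ) (ξ : Fin n → ℝ) :
    wittenSolution φ u ξ = ((Real.exp (2 * Real.pi * (toReal u ⬝ᵥ ξ - φ ξ)) : ℝ) : ℂ) := by
  rw [wittenSolution, ← Real.exp_add]
  congr 2
  ring

theorem norm_wittenSolution {n : ℕ} (φ : (Fin n → ℝ) → ℝ) (u : Fin n → ℤ) (ξ : Fin n → ℝ) :
    ‖wittenSolution φ u ξ‖ = Real.exp (2 * Real.pi * (toReal u ⬝ᵥ ξ - φ ξ)) := by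
  rw [wittenSolution_eq, Complex.norm_real, Real.norm_of_nonneg (Real.exp_pos _).le]

theorem wittenSolution_ne_zero {n : ℕ} (φ : (Fin n → ℝ) → ℝ) (u : Fin n → ℤ) (ξ : Fin n → ℝ) :
    wittenSolution φ u ξ ≠ 0 := by
  rw [wittenSolution_eq]
  exact_mod_cast (Real.exp_pos _).ne'

theorem isWittenClosed_const_mul_wittenSolution {n : ℕ} {φ : (Fin n → ℝ) → ℝ}
    (hφ : ContDiff ℝ ∞ φ) (m : Fin n → ℤ) (a : ℂ) :
    IsWittenClosed φ m (fun ξ => a * wittenSolution φ (-m) ξ) := by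
  simp only [wittenSolution_eq]
  refine ⟨?_, fun ξ w => ?_⟩
  · exact contDiff_const.mul (Complex.ofRealCLM.contDiff.comp
      (contDiff_const.mul ((contDiff_dotProduct _).sub hφ)).exp)
  · have h1 : HasFDerivAt φ (fderiv ℝ φ ξ) ξ :=
      (hφ.differentiable (by simp) ξ).hasFDerivAt
    have h2 := (((hasFDerivAt_dotProduct (toReal (-m)) ξ).sub h1).const_mul (2 * Real.pi)).exp
    have h3 := ((Complex.ofRealCLM.hasFDerivAt.comp ξ h2).const_mul a).fderiv
    simp only [Function.comp_def, Complex.ofRealCLM_apply, Pi.sub_apply] at h3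
    rw [wittenD, h3, velocity, add_dotProduct, differential_dotProduct]
    simp only [smul_apply, ContinuousLinearMap.comp_apply, sub_apply, dotCLM_apply, smul_eq_mul,
      Complex.ofRealCLM_apply, toReal_neg, neg_dotProduct]
    push_cast
    ring

/-- The product of `f` with the integrating factor `e^{2π(φ + ⟨m,ξ⟩)}` has zero derivative. -/
theorem IsWittenClosed.exists_eq_const_mul {n : ℕ} {φ : (Fin n → ℝ) → ℝ}
    (hφ : ContDiff ℝ ∞ φ) {m : Fin n → ℤ} {f : (Fin n → ℝ) → ℂ} (hf : IsWittenClosed φ m f) :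
    ∃ a : ℂ, ∀ ξ, f ξ = a * wittenSolution φ (-m) ξ := by
  have hd : ∀ ξ, HasFDerivAt (fun ξ => f ξ *
      ((Real.exp (2 * Real.pi * (φ ξ + toReal m ⬝ᵥ ξ)) : ℝ) : ℂ)) (0 : (Fin n → ℝ) →L[ℝ] ℂ) ξ := by
    intro ξ
    have h1 : HasFDerivAt φ (fderiv ℝ φ ξ) ξ :=
      (hφ.differentiable (by simp) ξ).hasFDerivAt
    have h2 := ((h1.add (hasFDerivAt_dotProduct (toReal m) ξ)).const_mul (2 * Real.pi)).exp
    have h3 : HasFDerivAt f (fderiv ℝ f ξ) ξ :=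
      (hf.1.differentiable (by simp) ξ).hasFDerivAt
    refine (h3.mul (Complex.ofRealCLM.hasFDerivAt.comp ξ h2)).congr_fderiv ?_
    ext w
    have h4 := hf.2 ξ w
    rw [wittenD, velocity, add_dotProduct, differential_dotProduct] at h4
    simp only [add_apply, smul_apply, ContinuousLinearMap.comp_apply, dotCLM_apply, smul_eq_mul,
      Complex.ofRealCLM_apply, Pi.add_apply, zero_apply, Function.comp_apply]
    push_cast at h4 ⊢
    linear_combination Complex.exp (2 * Real.pi * (φ ξ + ((toReal m ⬝ᵥ ξ : ℝ) : ℂ))) * h4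
  refine ⟨f 0 * ((Real.exp (2 * Real.pi * (φ 0 + toReal m ⬝ᵥ 0)) : ℝ) : ℂ), fun ξ => ?_⟩
  have h := is_const_of_fderiv_eq_zero (𝕜 := ℝ) (fun ξ => (hd ξ).differentiableAt)
    (fun ξ => (hd ξ).fderiv) 0 ξ
  have h1 : 2 * Real.pi * (φ ξ + toReal m ⬝ᵥ ξ) + 2 * Real.pi * (toReal (-m) ⬝ᵥ ξ - φ ξ) = 0 := by
    rw [toReal_neg, neg_dotProduct]
    ring
  rw [h, wittenSolution_eq, mul_assoc, ← Complex.ofReal_mul, ← Real.exp_add, h1]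
  simp

namespace SmoothCompleteFan

variable {n d : ℕ} (X : SmoothCompleteFan n d) (lam : Fin d → ℤ)

/-! ### The potential -/

/-- The sum over `B ∩ M` whose logarithm is the potential. -/
def charSum (c : (Fin n → ℤ) → ℝ) (ξ : Fin n → ℝ) : ℝ :=
  ∑ u ∈ (finite_latticePoints (X := X) (lam := lam)).toFinset,
    c u * Real.exp (4 * Real.pi * (toReal u ⬝ᵥ ξ))

theorem potential_eq (c : (Fin n → ℤ) → ℝ) (ξ : Fin n → ℝ) :
    X.potential lam c ξ = 1 / (4 * Real.pi) * Real.log (X.charSum lam c ξ) := by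
  rw [potential, charSum, finsum_mem_eq_finite_toFinset_sum _ finite_latticePoints]

theorem contDiff_charSum (c : (Fin n → ℤ) → ℝ) : ContDiff ℝ ∞ (X.charSum lam c) :=
  ContDiff.sum fun _ _ => contDiff_const.mul (contDiff_const.mul (contDiff_dotProduct _)).exp

theorem fderiv_charSum (c : (Fin n → ℤ) → ℝ) (ξ v : Fin n → ℝ) :
    fderiv ℝ (X.charSum lam c) ξ v =
      4 * Real.pi * ∑ u ∈ (finite_latticePoints (X := X) (lam := lam)).toFinset,
        c u * Real.exp (4 * Real.pi * (toReal u ⬝ᵥ ξ)) * (toReal u ⬝ᵥ v) := by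
  have h : HasFDerivAt (X.charSum lam c) _ ξ := HasFDerivAt.fun_sum
    fun u (_ : u ∈ (finite_latticePoints (X := X) (lam := lam)).toFinset) =>
      (((hasFDerivAt_dotProduct (toReal u) ξ).const_mul (4 * Real.pi)).exp.const_mul (c u))
  rw [h.fderiv, sum_apply, Finset.mul_sum]
  refine Finset.sum_congr rfl fun u _ => ?_
  simp only [smul_apply, dotCLM_apply, smul_eq_mul]
  ring

variable {X lam} {c : (Fin n → ℤ) → ℝ}

theorem term_le_charSum (hc : ∀ u ∈ X.latticePoints lam, 0 ≤ c u) {u : Fin n → ℤ}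
    (hu : u ∈ X.latticePoints lam) (ξ : Fin n → ℝ) :
    c u * Real.exp (4 * Real.pi * (toReal u ⬝ᵥ ξ)) ≤ X.charSum lam c ξ :=
  Finset.single_le_sum (f := fun u => c u * Real.exp (4 * Real.pi * (toReal u ⬝ᵥ ξ)))
    (fun w hw => mul_nonneg (hc w (by simpa using hw)) (Real.exp_pos _).le) (by simpa using hu)

theorem IsAmple.charSum_pos (hlam : X.IsAmple lam)
    (hc : ∀ u ∈ X.latticePoints lam, 0 ≤ c u) (hcv : ∀ p ∈ X.vertices lam, 0 < c p)
    (ξ : Fin n → ℝ) : 0 < X.charSum lam c ξ := by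
  obtain ⟨σ, hσ⟩ := X.maxCones_nonempty
  obtain ⟨p, hp, -⟩ := hlam.exists_vertex hσ
  exact (mul_pos (hcv p hp) (Real.exp_pos _)).trans_le
    (term_le_charSum hc (mem_latticePoints_of_mem_vertices hp) ξ)

theorem contDiff_potential (hZ : ∀ ξ, 0 < X.charSum lam c ξ) :
    ContDiff ℝ ∞ (X.potential lam c) := by
  have : X.potential lam c = fun ξ => 1 / (4 * Real.pi) * Real.log (X.charSum lam c ξ) :=
    funext fun ξ => X.potential_eq lam c ξ
  rw [this]
  exact contDiff_const.mul ((X.contDiff_charSum lam c).log fun ξ => (hZ ξ).ne')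

/-- `dφ(ξ)` is the mean of the lattice points of `B` with weights `c_u e^{4π⟨u,ξ⟩}`. -/
theorem facetFn_differential_mul (hZ : ∀ ξ, 0 < X.charSum lam c ξ) (k : Fin d) (ξ : Fin n → ℝ) :
    X.facetFn lam k (differential (X.potential lam c) ξ) * X.charSum lam c ξ =
      ∑ u ∈ (finite_latticePoints (X := X) (lam := lam)).toFinset,
        c u * Real.exp (4 * Real.pi * (toReal u ⬝ᵥ ξ)) * X.facetFn lam k (toReal u) := by
  have : X.potential lam c = fun ξ => 1 / (4 * Real.pi) * Real.log (X.charSum lam c ξ) :=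
    funext fun ξ => X.potential_eq lam c ξ
  have h1 : HasFDerivAt (X.charSum lam c) (fderiv ℝ (X.charSum lam c) ξ) ξ :=
    ((X.contDiff_charSum lam c).differentiable (by simp) ξ).hasFDerivAt
  have h2 := ((h1.log (hZ ξ).ne').const_mul (1 / (4 * Real.pi))).fderiv
  have hZ0 := (hZ ξ).ne'
  have hpi := Real.pi_ne_zero
  rw [facetFn, differential_dotProduct, this, h2]
  simp only [smul_apply, smul_eq_mul, fderiv_charSum, facetFn, mul_add, Finset.sum_add_distrib]
  rw [← Finset.sum_mul]
  change _ = _ + X.charSum lam c ξ * _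
  field_simp

theorem differential_mem_polytope (hZ : ∀ ξ, 0 < X.charSum lam c ξ)
    (hc : ∀ u ∈ X.latticePoints lam, 0 ≤ c u) (ξ : Fin n → ℝ) :
    differential (X.potential lam c) ξ ∈ X.polytope lam := by
  intro k
  refine nonneg_of_mul_nonneg_left ?_ (hZ ξ)
  rw [facetFn_differential_mul hZ]
  refine Finset.sum_nonneg fun u hu => ?_
  have hu' : u ∈ X.latticePoints lam := by simpa using hu
  exact mul_nonneg (mul_nonneg (hc u hu') (Real.exp_pos _).le) (hu' k)

end SmoothCompleteFan

namespace SmoothCompleteFan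

variable {n d : ℕ} {X : SmoothCompleteFan n d} {lam : Fin d → ℤ} {c : (Fin n → ℤ) → ℝ}

/-! ### Asymptotics along rays -/

/-- Every exponent satisfies `⟨u, -s v_k⟩ ≤ s λ_k`, which is `l_k(u) ≥ 0` scaled by `s`. -/
theorem charSum_neg_smul_gen_le (hc : ∀ u ∈ X.latticePoints lam, 0 ≤ c u) (k : Fin d) {s : ℝ}
    (hs : 0 ≤ s) :
    X.charSum lam c (-(s • toReal (X.gen k))) ≤
      X.charSum lam c 0 * Real.exp (4 * Real.pi * (s * lam k)) := by
  rw [charSum, charSum, Finset.sum_mul]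
  refine Finset.sum_le_sum fun u hu => ?_
  have hu' : u ∈ X.latticePoints lam := by simpa using hu
  have h1 := hu' k
  have h2 := hc u hu'
  have h3 : toReal u ⬝ᵥ (-(s • toReal (X.gen k))) ≤ s * lam k := by
    rw [dotProduct_neg, dotProduct_smul, smul_eq_mul]
    simp only [facetFn] at h1
    nlinarith
  rw [dotProduct_zero, mul_zero, Real.exp_zero, mul_one]
  have := Real.pi_pos
  gcongr

/-- If `u` violates the `k`-th inequality, then `f_u` is unbounded along the ray of `-v_k`. -/
theorem exists_lt_norm_wittenSolution (hZ : ∀ ξ, 0 < X.charSum lam c ξ)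
    (hc : ∀ u ∈ X.latticePoints lam, 0 ≤ c u) {u : Fin n → ℤ} {k : Fin d}
    (hu : X.facetFn lam k (toReal u) < 0) (C : ℝ) :
    ∃ s : ℝ, 0 ≤ s ∧
      C < ‖wittenSolution (X.potential lam c) u (-(s • toReal (X.gen k)))‖ := by
  set b := -X.facetFn lam k (toReal u) with hb
  have hb0 : 0 < b := by simpa [hb] using hu
  set L := Real.log (X.charSum lam c 0) with hL
  have hpi := Real.pi_pos
  -- With this `s` the exponent of `f_u` is at least `|C| + |L| - L/2`, and `e^x ≥ 1 + x` exceeds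
  -- `C`.
  refine ⟨(|C| + |L|) / (2 * Real.pi * b), by positivity, ?_⟩
  set s := (|C| + |L|) / (2 * Real.pi * b) with hs
  have hs0 : 0 ≤ s := by positivity
  have hsb : 2 * Real.pi * (s * b) = |C| + |L| := by
    rw [hs]; field_simp
  have h1 : Real.log (X.charSum lam c (-(s • toReal (X.gen k)))) ≤
      L + 4 * Real.pi * (s * lam k) := by
    rw [hL, ← Real.log_exp (4 * Real.pi * (s * lam k)),
      ← Real.log_mul (hZ 0).ne' (Real.exp_pos _).ne']
    exact Real.log_le_log (hZ _) (charSum_neg_smul_gen_le hc k hs0)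
  have h2 : 2 * Real.pi * X.potential lam c (-(s • toReal (X.gen k))) =
      Real.log (X.charSum lam c (-(s • toReal (X.gen k)))) / 2 := by
    rw [potential_eq]
    field_simp
    ring
  rw [norm_wittenSolution, mul_sub, h2, dotProduct_neg, dotProduct_smul, smul_eq_mul]
  have h3 : 2 * Real.pi * -(s * (toReal u ⬝ᵥ toReal (X.gen k))) =
      2 * Real.pi * (s * b) + 2 * Real.pi * (s * lam k) := by
    rw [hb, facetFn]; ring
  rw [h3, hsb]
  refine lt_of_lt_of_le ?_ (Real.add_one_le_exp _)
  linarith [le_abs_self C, le_abs_self L, abs_nonneg L]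

/-- `dφ` is a weighted mean of lattice points. As `p` lies on the facet `k`, its term grows at the
maximal rate `e^{4πsλ_k}`, so its weight never drops below `c_p` divided by the sum at `0`. Hence
the ray stays away from the facets not containing `p`. -/
theorem le_facetFn_differential_ray (hZ : ∀ ξ, 0 < X.charSum lam c ξ)
    (hc : ∀ u ∈ X.latticePoints lam, 0 ≤ c u) {p : Fin n → ℤ} (hp : p ∈ X.latticePoints lam)
    {k : Fin d} (hk : X.facetFn lam k (toReal p) = 0) {s : ℝ} (hs : 0 ≤ s) (j : Fin d) :
    c p / X.charSum lam c 0 * X.facetFn lam j (toReal p) ≤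
      X.facetFn lam j (differential (X.potential lam c) (-(s • toReal (X.gen k)))) := by
  set ξ := -(s • toReal (X.gen k)) with hξ
  have hj := hp j
  have h1 : c p * Real.exp (4 * Real.pi * (s * lam k)) * X.facetFn lam j (toReal p) ≤
      X.facetFn lam j (differential (X.potential lam c) ξ) * X.charSum lam c ξ := by
    rw [facetFn_differential_mul hZ]
    have h2 : s * (lam k : ℝ) = toReal p ⬝ᵥ ξ := by
      rw [hξ, dotProduct_neg, dotProduct_smul, smul_eq_mul]
      simp only [facetFn] at hk
      linear_combination s * hk
    rw [h2]
    refine Finset.single_le_sum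
      (f := fun u => c u * Real.exp (4 * Real.pi * (toReal u ⬝ᵥ ξ)) * X.facetFn lam j (toReal u))
      (fun w hw => ?_) (by simpa using hp)
    have hw' : w ∈ X.latticePoints lam := by simpa using hw
    exact mul_nonneg (mul_nonneg (hc w hw') (Real.exp_pos _).le) (hw' j)
  have h2 := charSum_neg_smul_gen_le hc k hs
  have h3 := mul_le_mul_of_nonneg_left h2 (differential_mem_polytope hZ hc ξ j)
  have h4 := h1.trans h3
  rw [div_mul_eq_mul_div, div_le_iff₀ (hZ 0)]
  refine le_of_mul_le_mul_right ?_ (Real.exp_pos (4 * Real.pi * (s * lam k)))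
  linarith

/-! ### Boundedness of the chart coordinates -/

/-- If `-ξ = ∑ s_i v_i` in the cone of the vertex `q`, a lattice point with `l_k(u) ≥ 1` has
exponential at most `e^{-4πs_k}` times that of `q`. Only such points contribute to `l_k(dφ(ξ))`, so
a lower bound `ε` on that value bounds `s_k`. -/
theorem exists_coeff_le (hZ : ∀ ξ, 0 < X.charSum lam c ξ)
    (hc : ∀ u ∈ X.latticePoints lam, 0 ≤ c u) {τ : Finset (Fin d)} {q : Fin n → ℤ}
    (hq : q ∈ X.latticePoints lam) (hcq : 0 < c q) (hqτ : ∀ k ∈ τ, X.facetFn lam k (toReal q) = 0)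
    {k : Fin d} (hk : k ∈ τ) {ε : ℝ} (hε : 0 < ε) :
    ∃ S : ℝ, 0 ≤ S ∧ ∀ (ξ : Fin n → ℝ) (s : Fin d → ℝ), (∀ i, 0 ≤ s i) →
      (∀ x : Fin n → ℝ, x ⬝ᵥ (-ξ) = ∑ i ∈ τ, s i * (x ⬝ᵥ toReal (X.gen i))) →
      ε ≤ X.facetFn lam k (differential (X.potential lam c) ξ) → s k ≤ S := by
  set D := ∑ u ∈ (finite_latticePoints (X := X) (lam := lam)).toFinset,
    c u * X.facetFn lam k (toReal u) with hD
  have hD0 : 0 ≤ D := Finset.sum_nonneg fun u hu => by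
    have hu' : u ∈ X.latticePoints lam := by simpa using hu
    exact mul_nonneg (hc u hu') (hu' k)
  refine ⟨D / (ε * c q), by positivity, fun ξ s hs hx hle => ?_⟩
  have hterm : ∀ u ∈ X.latticePoints lam,
      Real.exp (4 * Real.pi * (toReal u ⬝ᵥ ξ)) * X.facetFn lam k (toReal u) ≤
        Real.exp (4 * Real.pi * (toReal q ⬝ᵥ ξ)) * Real.exp (-(4 * Real.pi * s k)) *
          X.facetFn lam k (toReal u) := by
    intro u hu
    rcases (hu k).eq_or_lt with h0 | h0
    · rw [← h0]; simp
    -- `l_k` is integral at lattice points.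
    have h1 : 1 ≤ X.facetFn lam k (toReal u) := by
      rw [facetFn_toReal] at h0 ⊢
      exact_mod_cast h0
    have h2 : (toReal u ⬝ᵥ ξ) - (toReal q ⬝ᵥ ξ) = -∑ i ∈ τ, s i * X.facetFn lam i (toReal u) := by
      have h3 := hx (toReal u - toReal q)
      rw [dotProduct_neg, sub_dotProduct] at h3
      rw [eq_neg_iff_add_eq_zero, ← neg_eq_iff_add_eq_zero, h3]
      refine Finset.sum_congr rfl fun i hi => ?_
      have h4 := hqτ i hi
      rw [sub_dotProduct]
      simp only [facetFn] at h4 ⊢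
      linear_combination -(s i) * h4
    have h3 : s k * X.facetFn lam k (toReal u) ≤ ∑ i ∈ τ, s i * X.facetFn lam i (toReal u) :=
      Finset.single_le_sum (f := fun i => s i * X.facetFn lam i (toReal u))
        (fun i _ => mul_nonneg (hs i) (hu i)) hk
    have h4 : s k ≤ s k * X.facetFn lam k (toReal u) := le_mul_of_one_le_right (hs k) h1
    rw [← Real.exp_add]
    refine mul_le_mul_of_nonneg_right (Real.exp_le_exp.2 ?_) h0.le
    have hpi := Real.pi_pos
    nlinarith
  have h1 : ε * (c q * Real.exp (4 * Real.pi * (toReal q ⬝ᵥ ξ))) ≤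
      Real.exp (4 * Real.pi * (toReal q ⬝ᵥ ξ)) * Real.exp (-(4 * Real.pi * s k)) * D := by
    calc ε * (c q * Real.exp (4 * Real.pi * (toReal q ⬝ᵥ ξ)))
        ≤ ε * X.charSum lam c ξ :=
          mul_le_mul_of_nonneg_left (term_le_charSum hc hq ξ) hε.le
      _ ≤ _ := mul_le_mul_of_nonneg_right hle (hZ ξ).le
      _ = _ := facetFn_differential_mul hZ k ξ
      _ ≤ _ := by
          rw [hD, Finset.mul_sum]
          refine Finset.sum_le_sum fun u hu => ?_
          have hu' : u ∈ X.latticePoints lam := by simpa using hu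
          have := mul_le_mul_of_nonneg_left (hterm u hu') (hc u hu')
          linarith
  have h2 : ε * c q ≤ Real.exp (-(4 * Real.pi * s k)) * D := by
    refine le_of_mul_le_mul_left ?_ (Real.exp_pos (4 * Real.pi * (toReal q ⬝ᵥ ξ)))
    linarith
  have h3 : ε * c q * Real.exp (4 * Real.pi * s k) ≤ D := by
    have := mul_le_mul_of_nonneg_right h2 (Real.exp_pos (4 * Real.pi * s k)).le
    rwa [mul_right_comm (Real.exp _), ← Real.exp_add, neg_add_cancel, Real.exp_zero, one_mul] at this
  rw [le_div_iff₀ (by positivity)]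
  have h4 := Real.add_one_le_exp (4 * Real.pi * s k)
  have h5 : s k ≤ Real.exp (4 * Real.pi * s k) := by
    nlinarith [Real.pi_gt_three, hs k]
  calc s k * (ε * c q) ≤ Real.exp (4 * Real.pi * s k) * (ε * c q) := by gcongr
    _ ≤ D := by linarith

/-- The toric coordinates of the chart at `p` are bounded over compact subsets of `B_p`. -/
theorem IsAmple.exists_coord_le (hlam : X.IsAmple lam)
    (hc : ∀ u ∈ X.latticePoints lam, 0 ≤ c u) (hcv : ∀ p ∈ X.vertices lam, 0 < c p)
    {p : Fin n → ℤ} (hp : p ∈ X.vertices lam)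
    (e : Fin n ≃ {k : Fin d // X.facetFn lam k (toReal p) = 0}) {K : Set (Fin n → ℝ)}
    (hK : IsCompact K) (hKp : K ⊆ X.vertexStar lam p) :
    ∃ R : ℝ, ∀ t : Fin n → ℝ, differential (X.potential lam c)
      (((X.chartMatrix lam e).map (Int.cast : ℤ → ℝ)).transpose.mulVec t) ∈ K → ∀ j, t j ≤ R := by
  have hZ := hlam.charSum_pos hc hcv
  -- The conditions sit inside the existential, with default value `0`, so that `choose` yields one
  -- total function `S` with finitely many values.
  have hS : ∀ (τ : Finset (Fin d)) (k : Fin d), ∃ S : ℝ, 0 ≤ S ∧ (τ ∈ X.maxCones → k ∈ τ →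
      X.facetFn lam k (toReal p) ≠ 0 → ∀ (ξ : Fin n → ℝ) (s : Fin d → ℝ), (∀ i, 0 ≤ s i) →
      (∀ x : Fin n → ℝ, x ⬝ᵥ (-ξ) = ∑ i ∈ τ, s i * (x ⬝ᵥ toReal (X.gen i))) →
      differential (X.potential lam c) ξ ∈ K → s k ≤ S) := by
    intro τ k
    by_cases hτ : τ ∈ X.maxCones ∧ k ∈ τ ∧ X.facetFn lam k (toReal p) ≠ 0
    · obtain ⟨hτ, hk, hkp⟩ := hτ
      obtain ⟨q, hq, hqτ⟩ := hlam.exists_vertex hτ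
      -- A facet missing `p` does not meet `B_p`, so its function has a positive minimum on the
      -- compact `K`.
      obtain ⟨ε, hε, hεK⟩ := hK.exists_forall_le' (X.continuous_facetFn lam k).continuousOn
        (a := 0) fun x hx => lt_of_le_of_ne ((hKp hx).1 k) fun h => hkp ((hKp hx).2 k h.symm)
      obtain ⟨S, hS0, hS⟩ := exists_coeff_le hZ hc (mem_latticePoints_of_mem_vertices hq) (hcv q hq)
        (fun i hi => (hqτ i).2 hi) hk hε
      exact ⟨S, hS0, fun _ _ _ ξ s hs hx hm => hS ξ s hs hx (hεK _ hm)⟩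
    · exact ⟨0, le_rfl, fun h1 h2 h3 => (hτ ⟨h1, h2, h3⟩).elim⟩
  choose S hS0 hS using hS
  obtain ⟨a, ha⟩ := hlam.exists_dual hp e
  set b : Finset (Fin d) → Fin n → ℝ := fun τ j =>
    ∑ k ∈ τ, S τ k * |toReal (a j) ⬝ᵥ toReal (X.gen k)| with hb
  have hb0 : ∀ τ j, 0 ≤ b τ j := fun τ j =>
    Finset.sum_nonneg fun k _ => mul_nonneg (hS0 τ k) (abs_nonneg _)
  refine ⟨∑ τ ∈ X.maxCones, ∑ j, b τ j, fun t ht j => ?_⟩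
  set ξ := ((X.chartMatrix lam e).map (Int.cast : ℤ → ℝ)).transpose.mulVec t with hξ
  have htj : t j = toReal (a j) ⬝ᵥ ξ := by
    rw [hξ, toReal_dotProduct_chart, Finset.sum_eq_single j]
    · rw [toReal_dotProduct, ha]; simp
    · intro i _ hij
      rw [toReal_dotProduct, ha]; simp [hij]
    · simp
  -- Now `tʲ = -∑ s_k ⟨a_j, v_k⟩`. For a facet through `p` the pairing is `0` or `1`, so the term
  -- only decreases `tʲ`; for any other facet `s_k` is bounded by `S`.
  obtain ⟨τ, hτ, s, hs, hx⟩ := X.exists_nonneg_coeff (-ξ)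
  have h1 : t j ≤ b τ j := by
    have h2 := hx (toReal (a j))
    rw [dotProduct_neg] at h2
    rw [htj, ← neg_neg (toReal (a j) ⬝ᵥ ξ), h2, ← Finset.sum_neg_distrib]
    refine Finset.sum_le_sum fun k hk => ?_
    by_cases hkp : X.facetFn lam k (toReal p) = 0
    · have h3 : 0 ≤ toReal (a j) ⬝ᵥ toReal (X.gen k) := by
        have := ha (e.symm ⟨k, hkp⟩) j
        rw [Equiv.apply_symm_apply] at this
        rw [toReal_dotProduct, this]
        split_ifs <;> simp
      have h4 := mul_nonneg (hs k) h3
      have h5 := mul_nonneg (hS0 τ k) (abs_nonneg (toReal (a j) ⬝ᵥ toReal (X.gen k)))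
      linarith
    · have h3 := hS τ k hτ hk hkp ξ s hs hx ht
      calc -(s k * (toReal (a j) ⬝ᵥ toReal (X.gen k)))
          = s k * -(toReal (a j) ⬝ᵥ toReal (X.gen k)) := by ring
        _ ≤ s k * |toReal (a j) ⬝ᵥ toReal (X.gen k)| :=
            mul_le_mul_of_nonneg_left (neg_le_abs _) (hs k)
        _ ≤ _ := mul_le_mul_of_nonneg_right h3 (abs_nonneg _)
  refine h1.trans ((Finset.single_le_sum (f := fun j => b τ j) (fun j _ => hb0 τ j)
    (Finset.mem_univ j)).trans (Finset.single_le_sum (f := fun τ => ∑ j, b τ j)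
    (fun τ _ => Finset.sum_nonneg fun j _ => hb0 τ j) hτ))

/-! ### Extension of the solutions over a chart -/

/-- The order of vanishing of the monomial of `u` along the coordinate hyperplanes of a chart. -/
def chartExponent {p : Fin n → ℤ} (e : Fin n ≃ {k : Fin d // X.facetFn lam k (toReal p) = 0})
    (u : Fin n → ℤ) (j : Fin n) : ℕ :=
  (u ⬝ᵥ X.gen (e j).1 + lam (e j).1).toNat

theorem intCast_chartExponent {p : Fin n → ℤ}
    (e : Fin n ≃ {k : Fin d // X.facetFn lam k (toReal p) = 0}) {u : Fin n → ℤ}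
    (hu : u ∈ X.latticePoints lam) (j : Fin n) :
    (chartExponent e u j : ℤ) = (u - p) ⬝ᵥ X.gen (e j).1 := by
  have h1 := hu (e j).1
  have h2 := (e j).2
  rw [facetFn_toReal] at h1 h2
  rw [chartExponent, Int.toNat_of_nonneg (by exact_mod_cast h1), sub_dotProduct]
  have h3 : p ⬝ᵥ X.gen (e j).1 + lam (e j).1 = 0 := by exact_mod_cast h2
  linarith

theorem sum_mul_chartExponent {p : Fin n → ℤ}
    (e : Fin n ≃ {k : Fin d // X.facetFn lam k (toReal p) = 0}) {u : Fin n → ℤ}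
    (hu : u ∈ X.latticePoints lam) (t : Fin n → ℝ) :
    ∑ j, t j * (chartExponent e u j : ℝ) = (toReal u - toReal p) ⬝ᵥ
      (((X.chartMatrix lam e).map (Int.cast : ℤ → ℝ)).transpose.mulVec t) := by
  rw [toReal_dotProduct_chart, ← toReal_sub]
  refine Finset.sum_congr rfl fun j _ => ?_
  rw [toReal_dotProduct, ← intCast_chartExponent e hu, Int.cast_natCast]

/-- `∑_w c_w ∏ⱼ |Zʲ|^{2 lⱼ(w)}`, the sum defining the potential in toric coordinates. -/
def chartSum {p : Fin n → ℤ} (e : Fin n ≃ {k : Fin d // X.facetFn lam k (toReal p) = 0})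
    (c : (Fin n → ℤ) → ℝ) (z : Fin n → ℂ) : ℝ :=
  ∑ w ∈ (finite_latticePoints (X := X) (lam := lam)).toFinset,
    c w * ∏ j, (‖z j‖ ^ 2) ^ chartExponent e w j

/-- The smooth extension to `ℂⁿ` of the Fourier mode that corresponds to `f_u`. -/
def chartExtension {p : Fin n → ℤ} (e : Fin n ≃ {k : Fin d // X.facetFn lam k (toReal p) = 0})
    (c : (Fin n → ℤ) → ℝ) (u : Fin n → ℤ) (z : Fin n → ℂ) : ℂ :=
  (∏ j, z j ^ chartExponent e u j) *
    ((Real.exp (-(1 / 2) * Real.log (chartSum e c z)) : ℝ) : ℂ)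

/-- The exponents of `p` in its own chart vanish, so its term is the constant `c_p`. -/
theorem chartSum_pos {p : Fin n → ℤ}
    (e : Fin n ≃ {k : Fin d // X.facetFn lam k (toReal p) = 0})
    (hc : ∀ u ∈ X.latticePoints lam, 0 ≤ c u) (hp : p ∈ X.latticePoints lam) (hcp : 0 < c p)
    (z : Fin n → ℂ) : 0 < chartSum e c z := by
  have h0 : ∀ j, chartExponent e p j = 0 := fun j => by
    have := intCast_chartExponent e hp j
    rw [sub_self, zero_dotProduct] at this
    exact_mod_cast this
  have h1 := Finset.single_le_sum
    (f := fun w => c w * ∏ j, (‖z j‖ ^ 2) ^ chartExponent e w j)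
    (s := (finite_latticePoints (X := X) (lam := lam)).toFinset)
    (fun w hw => mul_nonneg (hc w (by simpa using hw))
      (Finset.prod_nonneg fun j _ => by positivity)) (by simpa using hp : p ∈ _)
  simp only [h0, pow_zero, Finset.prod_const_one, mul_one] at h1
  exact hcp.trans_le h1

theorem contDiff_chartExtension {p : Fin n → ℤ}
    (e : Fin n ≃ {k : Fin d // X.facetFn lam k (toReal p) = 0})
    (hc : ∀ u ∈ X.latticePoints lam, 0 ≤ c u) (hp : p ∈ X.latticePoints lam) (hcp : 0 < c p)
    (u : Fin n → ℤ) : ContDiff ℝ ∞ (chartExtension e c u) := by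
  have hz : ∀ j : Fin n, ContDiff ℝ ∞ (fun z : Fin n → ℂ => z j) := fun j =>
    contDiff_apply ℝ ℂ j
  have hP : ContDiff ℝ ∞ (chartSum e c) :=
    ContDiff.sum fun _ _ => contDiff_const.mul
      (contDiff_prod fun j _ => ((hz j).norm_sq ℝ).pow _)
  exact (contDiff_prod fun j _ => (hz j).pow _).mul (Complex.ofRealCLM.contDiff.comp
    (contDiff_const.mul (hP.log fun z => (chartSum_pos e hc hp hcp z).ne')).exp)

/-- The moduli `|Zʲ|^{2 l_j(w)}` multiply to `e^{4π⟨w - p, ξ⟩}`, since `∑ tʲ l_j(w) = ⟨w - p, ξ⟩`.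
-/
theorem chartSum_toricCoord {p : Fin n → ℤ}
    (e : Fin n ≃ {k : Fin d // X.facetFn lam k (toReal p) = 0}) (t y : Fin n → ℝ) :
    chartSum e c (toricCoord t y) = X.charSum lam c
        (((X.chartMatrix lam e).map (Int.cast : ℤ → ℝ)).transpose.mulVec t) *
      Real.exp (-(4 * Real.pi * (toReal p ⬝ᵥ
        (((X.chartMatrix lam e).map (Int.cast : ℤ → ℝ)).transpose.mulVec t)))) := by
  rw [chartSum, charSum, Finset.sum_mul]
  refine Finset.sum_congr rfl fun w hw => ?_
  have hw' : w ∈ X.latticePoints lam := by simpa using hw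
  rw [mul_assoc, ← Real.exp_add]
  congr 1
  simp only [norm_toricCoord, ← Real.exp_nat_mul, ← Real.exp_sum]
  congr 1
  have := sum_mul_chartExponent e hw' t
  rw [sub_dotProduct] at this
  rw [← sub_eq_add_neg, ← mul_sub, ← this, Finset.mul_sum]
  refine Finset.sum_congr rfl fun j _ => ?_
  push_cast
  ring

/-- The phase of `Zʲ` is `e^{-2πiyʲ}`, hence the negative mode. The modulus `e^{2π⟨u - p, ξ⟩}` of
the monomial is corrected by the factor `e^{2π⟨p, ξ⟩}` coming from the square root of the sum. -/
theorem chartExtension_toricCoord (hZ : ∀ ξ, 0 < X.charSum lam c ξ) {p : Fin n → ℤ}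
    (e : Fin n ≃ {k : Fin d // X.facetFn lam k (toReal p) = 0}) {u : Fin n → ℤ}
    (hu : u ∈ X.latticePoints lam) (t y : Fin n → ℝ) :
    chartExtension e c u (toricCoord t y) =
      modeChar (fun j => -(chartExponent e u j : ℤ)) y *
        wittenSolution (X.potential lam c) u
          (((X.chartMatrix lam e).map (Int.cast : ℤ → ℝ)).transpose.mulVec t) := by
  have hs := sum_mul_chartExponent e hu t
  rw [chartExtension, chartSum_toricCoord, wittenSolution_eq]
  set ξ := ((X.chartMatrix lam e).map (Int.cast : ℤ → ℝ)).transpose.mulVec t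
  have hpi := Real.pi_ne_zero
  have h1 : -(1 / 2) * Real.log (X.charSum lam c ξ *
      Real.exp (-(4 * Real.pi * (toReal p ⬝ᵥ ξ)))) =
      2 * Real.pi * (toReal p ⬝ᵥ ξ - X.potential lam c ξ) := by
    rw [Real.log_mul (hZ ξ).ne' (Real.exp_pos _).ne', Real.log_exp, potential_eq]
    field_simp
    ring
  have h2 : ∏ j, toricCoord t y j ^ chartExponent e u j =
      modeChar (fun j => -(chartExponent e u j : ℤ)) y *
        ((Real.exp (2 * Real.pi * ((toReal u - toReal p) ⬝ᵥ ξ)) : ℝ) : ℂ) := by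
    simp only [toricCoord, ← Complex.exp_nat_mul, ← Complex.exp_sum]
    rw [modeChar, Complex.ofReal_exp, ← Complex.exp_add, ← hs]
    congr 1
    push_cast
    rw [Finset.mul_sum, Finset.mul_sum, ← Finset.sum_add_distrib]
    refine Finset.sum_congr rfl fun j _ => ?_
    ring
  rw [h1, h2, mul_assoc, ← Complex.ofReal_mul, ← Real.exp_add]
  congr 4
  rw [sub_dotProduct]
  ring

end SmoothCompleteFan

/-! ### Weakly extendable solutions -/

/-- Over a compact set the velocity is bounded on the single nonzero component, so beyond that bound
only zero components remain. -/
theorem rapidlyDecaying_single {n : ℕ} {φ : (Fin n → ℝ) → ℝ} (hφ : ContDiff ℝ ∞ φ)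
    (m : Fin n → ℤ) {f : (Fin n → ℝ) → ℂ} (hf : ContDiff ℝ ∞ f) :
    RapidlyDecaying φ (Pi.single m f) := by
  refine ⟨fun m' => ?_, fun K hK k l ε hε => ?_⟩
  · by_cases h : m' = m
    · subst h; simpa using hf
    · rw [Pi.single_eq_of_ne h]; exact contDiff_const
  · obtain ⟨R, hR⟩ := hK.exists_bound_of_continuousOn (f := fun ξ => velocity φ ξ m)
      ((continuous_differential hφ).add continuous_const).continuousOn
    refine ⟨R + 1, fun ξ hξ m' hm' => ?_⟩
    have h : m' ≠ m := by
      rintro rfl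
      linarith [hR ξ hξ]
    rw [Pi.single_eq_of_ne h]
    have h0 : iteratedFDeriv ℝ l (0 : (Fin n → ℝ) → ℂ) ξ = 0 := by
      rw [iteratedFDeriv_zero]; rfl
    rw [h0, norm_zero, mul_zero]
    exact hε.le

namespace SmoothCompleteFan

variable {n d : ℕ} {X : SmoothCompleteFan n d} {lam : Fin d → ℤ} {c : (Fin n → ℤ) → ℝ}

theorem chartMatrix_mulVec {p : Fin n → ℤ}
    (e : Fin n ≃ {k : Fin d // X.facetFn lam k (toReal p) = 0}) (u : Fin n → ℤ) (j : Fin n) :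
    (X.chartMatrix lam e).mulVec u j = u ⬝ᵥ X.gen (e j).1 := by
  rw [Matrix.mulVec, dotProduct_comm]
  rfl

/-- Only the mode `A(m + p)` is nonzero in the chart at `p`; it extends smoothly to `ℂⁿ`, and the
chart coordinates are bounded over the closure of `U`. -/
theorem IsAmple.weaklyExtendable_single (hlam : X.IsAmple lam)
    (hc : ∀ u ∈ X.latticePoints lam, 0 ≤ c u) (hcv : ∀ p ∈ X.vertices lam, 0 < c p)
    {m : Fin n → ℤ} (hm : -m ∈ X.latticePoints lam) (a : ℂ) :
    X.WeaklyExtendable lam (X.potential lam c)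
      (Pi.single m fun ξ => a * wittenSolution (X.potential lam c) (-m) ξ) := by
  have hZ := hlam.charSum_pos hc hcv
  have hφ := contDiff_potential hZ
  refine ⟨rapidlyDecaying_single hφ m (isWittenClosed_const_mul_wittenSolution hφ m a).1, ?_⟩
  intro p hp e U _ hUc hUp k w
  obtain ⟨R, hR⟩ := hlam.exists_coord_le hc hcv hp e hUc hUp
  have hpB := mem_latticePoints_of_mem_vertices hp
  obtain ⟨C, hC, hbound⟩ := exists_norm_covDeriv_le
    (contDiff_const.mul (contDiff_chartExtension e hc hpB (hcv p hp) (-m)) :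
      ContDiff ℝ ∞ fun z => a * chartExtension e c (-m) z)
    (fun j => -(chartExponent e (-m) j : ℤ))
    (fun t => a * wittenSolution (X.potential lam c) (-m)
      (((X.chartMatrix lam e).map (Int.cast : ℤ → ℝ)).transpose.mulVec t))
    (fun t y => by rw [chartExtension_toricCoord hZ e hm]; ring) R k w
  refine ⟨C, hC, fun m' t ht => ?_⟩
  by_cases h : (X.chartMatrix lam e)⁻¹.mulVec m' - p = m
  · have hm' : m' = fun j => -(chartExponent e (-m) j : ℤ) := by
      have h1 : m' = (X.chartMatrix lam e).mulVec (p + m) := by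
        rw [← h, add_sub_cancel, Matrix.mulVec_mulVec,
          Matrix.mul_nonsing_inv _ (hlam.isUnit_det_chartMatrix hp e), Matrix.one_mulVec]
      ext j
      rw [h1, chartMatrix_mulVec, intCast_chartExponent e hm, ← neg_dotProduct]
      congr 1
      abel
    have hg : X.chartMode lam e (Pi.single m fun ξ =>
        a * wittenSolution (X.potential lam c) (-m) ξ) m' = fun t =>
        a * wittenSolution (X.potential lam c) (-m)
          (((X.chartMatrix lam e).map (Int.cast : ℤ → ℝ)).transpose.mulVec t) := by
      ext t
      rw [chartMode, h, Pi.single_eq_same]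
    rw [hg, hm']
    exact hbound t fun j => hR t (subset_closure ht) j
  · have hg : X.chartMode lam e (Pi.single m fun ξ =>
        a * wittenSolution (X.potential lam c) (-m) ξ) m' = fun _ => 0 := by
      ext t
      rw [chartMode, Pi.single_eq_of_ne h]
      rfl
    rw [hg, covDeriv_zero, norm_zero]
    positivity

/-- A weakly extendable function on one component is bounded along the rays of `-v_k`. -/
theorem IsAmple.exists_norm_le_of_weaklyExtendable (hlam : X.IsAmple lam)
    (hc : ∀ u ∈ X.latticePoints lam, 0 ≤ c u) (hcv : ∀ p ∈ X.vertices lam, 0 < c p)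
    {m : Fin n → ℤ} {f : (Fin n → ℝ) → ℂ}
    (hf : X.WeaklyExtendable lam (X.potential lam c) (Pi.single m f)) (k : Fin d) :
    ∃ C : ℝ, ∀ s : ℝ, 0 ≤ s → ‖f (-(s • toReal (X.gen k)))‖ ≤ C := by
  have hZ := hlam.charSum_pos hc hcv
  obtain ⟨σ, hσ, hkσ⟩ := X.ray_mem k
  obtain ⟨p, hp, hpσ⟩ := hlam.exists_vertex hσ
  have hpB := mem_latticePoints_of_mem_vertices hp
  have hkp := (hpσ k).2 hkσ
  obtain ⟨e⟩ := hlam.exists_chart hp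
  set ε := c p / X.charSum lam c 0 with hε
  have hε0 : 0 < ε := div_pos (hcv p hp) (hZ 0)
  -- The ray satisfies `l_j ≥ ε l_j(p) ≥ ε` off the facets through `p`; halving `ε` leaves room for
  -- an open set whose closure stays in `B_p`.
  set O : Set (Fin n → ℝ) :=
    {x | ∀ j, X.facetFn lam j (toReal p) ≠ 0 → ε / 2 < X.facetFn lam j x} with hO
  have hOo : IsOpen O := by
    simp only [hO, Set.ofPred_forall]
    exact isOpen_iInter_of_finite fun j => isOpen_iInter_of_finite fun _ =>
      isOpen_lt continuous_const (X.continuous_facetFn lam j)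
  set T : Set (Fin n → ℝ) :=
    {x | ∀ j, X.facetFn lam j (toReal p) ≠ 0 → ε / 2 ≤ X.facetFn lam j x} with hT
  have hTc : IsClosed T := by
    simp only [hT, Set.ofPred_forall]
    exact isClosed_iInter fun j => isClosed_iInter fun _ =>
      isClosed_le continuous_const (X.continuous_facetFn lam j)
  have hcl : closure (O ∩ X.vertexStar lam p) ⊆ X.polytope lam ∩ T :=
    closure_minimal (fun x hx => ⟨hx.2.1, fun j hj => (hx.1 j hj).le⟩)
      (isClosed_polytope.inter hTc)
  have hTs : X.polytope lam ∩ T ⊆ X.vertexStar lam p := by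
    refine fun x hx => ⟨hx.1, fun j hj => ?_⟩
    by_contra h
    have := hx.2 j h
    linarith
  obtain ⟨C, -, hC⟩ := hf.2 p hp e (O ∩ X.vertexStar lam p) ⟨O, hOo, rfl⟩
    (isCompact_polytope.of_isClosed_subset isClosed_closure (hcl.trans Set.inter_subset_left))
    (hcl.trans hTs) 0 Fin.elim0
  refine ⟨C, fun s hs => ?_⟩
  set A := X.chartMatrix lam e with hA
  set t : Fin n → ℝ := Pi.single (e.symm ⟨k, hkp⟩) (-s) with ht
  have hξ : (A.map (Int.cast : ℤ → ℝ)).transpose.mulVec t = -(s • toReal (X.gen k)) := by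
    ext i
    rw [ht, Matrix.mulVec_single]
    simp [hA, chartMatrix, toReal, mul_comm]
  have hmem : differential (X.potential lam c) (-(s • toReal (X.gen k))) ∈
      O ∩ X.vertexStar lam p := by
    have hO' : differential (X.potential lam c) (-(s • toReal (X.gen k))) ∈ O := by
      intro j hj
      have h1 := le_facetFn_differential_ray hZ hc hpB hkp hs j
      have h2 : 1 ≤ X.facetFn lam j (toReal p) := by
        have h3 := lt_of_le_of_ne (hpB j) (Ne.symm hj)
        rw [facetFn_toReal] at h3 ⊢
        exact_mod_cast h3
      nlinarith
    exact ⟨hO', hTs ⟨differential_mem_polytope hZ hc _, fun j hj => (hO' j hj).le⟩⟩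
  -- In the chart at `p`, the component `m` appears as the mode `A(m + p)`.
  have h := hC (A.mulVec (m + p)) t (by rw [hξ]; exact hmem)
  have hinv : A⁻¹.mulVec (A.mulVec (m + p)) - p = m := by
    rw [Matrix.mulVec_mulVec, Matrix.nonsing_inv_mul _ (hlam.isUnit_det_chartMatrix hp e),
      Matrix.one_mulVec, add_sub_cancel_right]
  rw [covDeriv, chartMode, ← hA, hinv, hξ, Pi.single_eq_same] at h
  simpa using h

end SmoothCompleteFan

end ToricSYZ

end

/-! ### The main theorem -/

open ToricSYZ ToricSYZ.SmoothCompleteFan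

theorem mainTheorem6 {n d : ℕ} (X : ToricSYZ.SmoothCompleteFan n d) (lam : Fin d → ℤ)
    (hlam : X.IsAmple lam) (c : (Fin n → ℤ) → ℝ)
    (hc : ∀ u ∈ X.latticePoints lam, 0 ≤ c u) (hcv : ∀ p ∈ X.vertices lam, 0 < c p)
    (m : Fin n → ℤ) :
    (∀ f : (Fin n → ℝ) → ℂ,
      (f ≠ 0 ∧ ToricSYZ.IsWittenClosed (X.potential lam c) m f ∧
        X.WeaklyExtendable lam (X.potential lam c) (Pi.single m f)) ↔
      ∃ u ∈ X.latticePoints lam, u = -m ∧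
        ∃ a : ℂ, a ≠ 0 ∧ ∀ ξ, f ξ = a * ToricSYZ.wittenSolution (X.potential lam c) u ξ) ∧
    (∀ u : Fin n → ℤ, u = -m → u ∉ X.latticePoints lam →
      ToricSYZ.IsWittenClosed (X.potential lam c) m
        (ToricSYZ.wittenSolution (X.potential lam c) u) ∧
      ∀ f : (Fin n → ℝ) → ℂ, f ≠ 0 → ToricSYZ.IsWittenClosed (X.potential lam c) m f →
        ¬ ∃ C : ℝ, ∀ ξ, ‖f ξ‖ ≤ C) := by
  have hZ := hlam.charSum_pos hc hcv
  have hφ := contDiff_potential hZ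
  have hsol : ∀ f : (Fin n → ℝ) → ℂ, f ≠ 0 → IsWittenClosed (X.potential lam c) m f →
      ∃ a : ℂ, a ≠ 0 ∧ ∀ ξ, f ξ = a * wittenSolution (X.potential lam c) (-m) ξ := by
    intro f hf0 hf
    obtain ⟨a, ha⟩ := hf.exists_eq_const_mul hφ
    refine ⟨a, ?_, ha⟩
    rintro rfl
    exact hf0 (funext fun ξ => by simp [ha])
  -- Unboundedness is located on a ray `-s v_k`: the second claim needs only unboundedness, but the
  -- first needs it where weak extendability gives a bound.
  have hunb : -m ∉ X.latticePoints lam → ∀ f : (Fin n → ℝ) → ℂ, f ≠ 0 →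
      IsWittenClosed (X.potential lam c) m f →
      ∃ k, ¬ ∃ C : ℝ, ∀ s : ℝ, 0 ≤ s → ‖f (-(s • toReal (X.gen k)))‖ ≤ C := by
    intro hm f hf0 hf
    obtain ⟨k, hk⟩ := not_forall.1 hm
    refine ⟨k, fun ⟨C, hC⟩ => ?_⟩
    obtain ⟨a, ha0, ha⟩ := hsol f hf0 hf
    obtain ⟨s, hs, hlt⟩ := exists_lt_norm_wittenSolution hZ hc (not_le.1 hk) (C / ‖a‖)
    have h := hC s hs
    rw [ha, norm_mul] at h
    rw [div_lt_iff₀' (norm_pos_iff.2 ha0)] at hlt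
    exact absurd h (not_le.2 hlt)
  refine ⟨fun f => ⟨?_, ?_⟩, ?_⟩
  · rintro ⟨hf0, hf, hext⟩
    refine ⟨-m, ?_, rfl, hsol f hf0 hf⟩
    by_contra hm
    obtain ⟨k, hk⟩ := hunb hm f hf0 hf
    exact hk (hlam.exists_norm_le_of_weaklyExtendable hc hcv hext k)
  · rintro ⟨_, hu, rfl, a, ha0, ha⟩
    obtain rfl : f = fun ξ => a * wittenSolution (X.potential lam c) (-m) ξ := funext ha
    exact ⟨fun h => mul_ne_zero ha0 (wittenSolution_ne_zero _ _ 0) (congrFun h 0),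
      isWittenClosed_const_mul_wittenSolution hφ m a, hlam.weaklyExtendable_single hc hcv hu a⟩
  · rintro _ rfl hm
    refine ⟨by simpa using isWittenClosed_const_mul_wittenSolution hφ m 1, fun f hf0 hf => ?_⟩
    rintro ⟨C, hC⟩
    obtain ⟨k, hk⟩ := hunb hm f hf0 hf
    exact hk ⟨C, fun s _ => hC _⟩
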